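/- Conventions. Strings are finite words over $\{0,1\}$, and a natural number is written as a string in binary, least significant digit first, so that the number $0$ is the empty string. Turing machines are deterministic multitape machines with a separate tape for each input, an output tape and any number of work tapes; the output is read on the output tape from the head rightwards up to the first symbol that is not a bit. A function of one or two strings, with strings as values, is *quadratic time computable* if some such machine computes it and, for some constant $c$, halts within $c(n^2+1)$ steps on all inputs of total length $n$. A *clocked machine* is a pair $(M,c)$ of such a machine (given by its finite program) and a constant $c\in\mathbb N$; it computes the unary function that sends a string $w$ of length $n$ to the output of $M$ on input $w$ at the moment when $M$ halts or, if this comes first, is stopped after $c(n^2+1)$ steps. For a binary function $G$ and a string $w$, let $G_w$ be the function $v\mapsto G(w,v)$, and let $E_G=\{\langle w,w'\rangle : G_w=G_{w'}\}$. An equivalence relation $E$ (on numbers, or on finite objects coded by numbers) is *$\Pi^0_1$-complete* if its complement is recursively enumerable and for every equivalence relation $S$ on $\mathbb N$ with recursively enumerable complement there is a computable function $f$ such that, for all $x,y$, $x\,S\,y$ if and only if $f(x)\,E\,f(y)$. **Theorem.** (Lemma) For each computable function $g:\mathbb N\times\mathbb N\to\mathbb N$ there are a quadratic time computable binary function $G$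 on strings and a computable function $p$ from numbers to strings such that $G(p(x),p(n))=g(x,n)$ for all $x,n$, and $G(w,v)=0$ for every string $w$ and every string $v$ that is not of the form $p(n)$. (i) There is a quadratic time computable binary function $G$ on strings such that $E_G$ is a $\Pi^0_1$-complete equivalence relation. (ii) Equality of unary quadratic time computable functions, $\{\langle e,e'\rangle : e \text{ and } e' \text{ are clocked machines that compute the same function}\}$, is a $\Pi^0_1$-complete equivalence relation. -/

import Mathlib

/-! Multitape Turing machines as finite objects, quadratic time, and complete `Π⁰₁` equivalence
relations. Numbers serve as names of states and of tape symbols; as a machine has only finitely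
many instructions, it uses only finitely many of them. -/

namespace QuadTime

/-- Binary strings. -/
abbrev Str := List Bool

/-- Tape symbols: `0` is the blank, `1` and `2` stand for the bits 0 and 1, and the larger numbers
are further symbols of the tape alphabet. -/
abbrev Sym := ℕ

/-- The tape symbol of a bit. -/
def bitSym (b : Bool) : Sym := cond b 2 1

/-- A two-way infinite tape with a head: the cells left of the head, from right to left, and the
cells from the head (included) to the right. All cells that are not listed are blank. -/
abbrev Tape := List Sym × List Sym

namespace Tape

/-- The empty tape. -/
def blank : Tape := ([], [])

/-- The tape that holds the string `w`, with the head on its first symbol. -/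
def ofStr (w : Str) : Tape := ([], w.map bitSym)

/-- The symbol under the head. -/
def head (T : Tape) : Sym := T.2.headD 0

/-- Overwrite the symbol under the head. -/
def write (T : Tape) (a : Sym) : Tape := (T.1, a :: T.2.tail)

/-- Move the head: `none` stays, `some false` goes one cell left, `some true` one cell right. -/
def move (T : Tape) : Option Bool → Tape
  | none => T
  | some false => (T.1.tail, T.1.headD 0 :: T.2)
  | some true => (T.2.headD 0 :: T.1, T.2.tail)

end Tape

/-- The longest string of bits at the beginning of a list of symbols. -/
def readBits : List Sym → Str
  | 1 :: l => false :: readBits l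
  | 2 :: l => true :: readBits l
  | _ => []

/-- What an instruction does on one tape: the symbol it has to see under the head, the symbol it
writes in its place, and the move of the head. -/
abbrev Action := Sym × Sym × Option Bool

/-- An instruction: the current state, one action for each tape, and the next state. -/
abbrev Instr := ℕ × List Action × ℕ

/-- A deterministic multitape Turing machine: the number of its work tapes (it also has an output
tape and one tape for each input) and its program. If several instructions fit a configuration,
then the first of them is the one that counts; if none fits, then the machine halts. -/
abbrev Machine := ℕ × List Instr

/-- A configuration: the state and the tapes. -/
abbrev Config := ℕ × List Tape

/-- The initial configuration on the given inputs: state `0`, the output tape (which comes first)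
and the work tapes are blank, and each input stands on its own tape. -/
def Machine.init (M : Machine) (inputs : List Str) : Config :=
  (0, Tape.blank :: (inputs.map Tape.ofStr ++ List.replicate M.1 Tape.blank))

/-- The instruction that the machine carries out in a given configuration, if any. -/
def Machine.instr? (M : Machine) (C : Config) : Option Instr :=
  M.2.find? fun I => decide (I.1 = C.1 ∧ I.2.1.map (fun a => a.1) = C.2.map Tape.head)

/-- Carry out an instruction, on all tapes at once. -/
def Instr.exec (I : Instr) (C : Config) : Config :=
  (I.2.2, List.zipWith (fun (a : Action) (T : Tape) => (T.write a.2.1).move a.2.2) I.2.1 C.2)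

/-- One step of the machine; a halting configuration does not change. -/
def Machine.step (M : Machine) (C : Config) : Config :=
  match M.instr? C with
  | none => C
  | some I => I.exec C

/-- The machine halts in the configuration: no instruction fits. -/
def Machine.Halted (M : Machine) (C : Config) : Prop := M.instr? C = none

/-- The configuration in which the machine is after `t` steps on the given inputs
(or in which it halted before). -/
def Machine.run (M : Machine) (inputs : List Str) (t : ℕ) : Config :=
  M.step^[t] (M.init inputs)

/-- The output in a configuration: the bits on the output tape, from the head rightwards up to the
first symbol that is not a bit. -/
def Config.output (C : Config) : Str := readBits (C.2.headD Tape.blank).2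

/-- A unary function on strings is quadratic time computable: some multitape machine computes it
and halts in `O(n²)` steps, where `n` is the length of the input. -/
def IsQuadTime₁ (f : Str → Str) : Prop :=
  ∃ (M : Machine) (c : ℕ), ∀ w : Str, ∃ t ≤ c * (w.length ^ 2 + 1),
    M.Halted (M.run [w] t) ∧ (M.run [w] t).output = f w

/-- A binary function on strings is quadratic time computable: some multitape machine computes it
and halts in `O(n²)` steps, where `n` is the total length of the two inputs. -/
def IsQuadTime₂ (G : Str → Str → Str) : Prop :=
  ∃ (M : Machine) (c : ℕ), ∀ w v : Str, ∃ t ≤ c * ((w.length + v.length) ^ 2 + 1),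
    M.Halted (M.run [w, v] t) ∧ (M.run [w, v] t).output = G w v

/-- An index of a unary quadratic time function: a multitape machine with a clock, which is given
by a constant `c` and stops the machine after `c * (n ^ 2 + 1)` steps on inputs of length `n`. -/
abbrev ClockedIndex := Machine × ℕ

/-- The function computed by a clocked machine: the output at the time when the machine halts or is
stopped by its clock. -/
def ClockedIndex.eval (e : ClockedIndex) (w : Str) : Str :=
  (e.1.run [w] (e.2 * (w.length ^ 2 + 1))).output

/-- A machine that has halted keeps its configuration. -/
theorem Machine.run_eq_of_halted {M : Machine} {inputs : List Str} {t : ℕ}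
    (h : M.Halted (M.run inputs t)) {s : ℕ} (hs : t ≤ s) : M.run inputs s = M.run inputs t := by
  obtain ⟨k, rfl⟩ := Nat.exists_eq_add_of_le' hs
  have hfix : M.step (M.run inputs t) = M.run inputs t := by
    unfold Machine.Halted at h
    simp [Machine.step, h]
  have := Function.iterate_fixed hfix k
  rwa [Machine.run, Function.iterate_add_apply]

/-- The clocked machines list all unary quadratic time computable functions. -/
theorem IsQuadTime₁.exists_index {f : Str → Str} (hf : IsQuadTime₁ f) :
    ∃ e : ClockedIndex, e.eval = f := by
  obtain ⟨M, c, h⟩ := hf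
  refine ⟨(M, c), funext fun w => ?_⟩
  obtain ⟨t, ht, hhalt, hout⟩ := h w
  rw [ClockedIndex.eval, Machine.run_eq_of_halted hhalt ht, hout]

/-- The equivalence relation `E_G`: two arguments are related if the sections of `G` at them are the
same function. -/
def sectionEq {α β γ : Type*} (G : α → β → γ) (x y : α) : Prop := G x = G y

/-- A binary relation is `Π⁰₁`: its complement is recursively enumerable. -/
def IsPi01 {α : Type*} [Primcodable α] (R : α → α → Prop) : Prop :=
  REPred fun p : α × α => ¬ R p.1 p.2

/-- Computable (componentwise) reducibility of binary relations. -/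
def CompReducible {α β : Type*} [Primcodable α] [Primcodable β]
    (R : α → α → Prop) (S : β → β → Prop) : Prop :=
  ∃ f : α → β, Computable f ∧ ∀ x y, R x y ↔ S (f x) (f y)

/-- A `Π⁰₁`-complete equivalence relation: a `Π⁰₁` equivalence relation to which every `Π⁰₁`
equivalence relation on the natural numbers is computably reducible. -/
def IsPi01CompleteEquivalence {α : Type*} [Primcodable α] (R : α → α → Prop) : Prop :=
  Equivalence R ∧ IsPi01 R ∧
    ∀ S : ℕ → ℕ → Prop, Equivalence S → IsPi01 S → CompReducible S R

end QuadTime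

/-!
Padding makes a computable function `g` quadratic time computable. The padded form `p n` of a
number `n` consists of a table of the values `g i n` and `g n i` for `i ≤ n`, written in pairs of
bits other than `00`, then of `0000`, and then of as many zeros as a fixed one-tape machine `M`
needs steps to recognize the table. The tables form a recursively enumerable set, so there is a
machine `M` that halts exactly on them (`exists_TM0_of_rePred`). The machine for `G` copies the
table at the beginning of its second input to the work tape and runs `M` on it, using up one zero
of the padding for each step of `M`; it goes on only if `M` halts exactly at the end of the
padding. Hence the check takes linear time, whatever the running time of `M`, and it is passed by
the strings `p n` and by no others (`exists_certificates`). On a string that fails, the output is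
empty, which is the number `0`. If the second input is `p n`, then the machine goes through the
tables at the beginning of both inputs in parallel, one block at a time, to the end of the shorter
one: if the first input is `p x`, then it finds `g x n` there, in the second table if `x ≤ n` and
in the first one otherwise (`reaches_lookupValue`, `lookupValue_valueTable`). The first input need
not be validated, because any string as the first input leads to a halt after linearly many steps
(`exists_halt`). This gives `exists_quadTime_padding`.

A `Π⁰₁` equivalence relation `S` is equality of the sections of some computable `g`
(`exists_computable_sectionEq`): if two numbers are inequivalent, then they are separated by a
computable function with two values that is constant on the classes of `S`, and such functions are
obtained uniformly by giving values to the numbers one after the other. With `G` and `p` for this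
`g`, two numbers `x` and `y` are `S`-equivalent if and only if the sections of `G` at `p x` and
`p y` are the same function, and a clocked machine for the section at `p x` is computed from `x`
by writing `p x` into the program of a machine for `G` (`hardwireMachine`). So equality of clocked
machines is complete. Padding the function that evaluates clocked machines on strings turns this
into the completeness of `E_G` for a single `G`.
-/

open Turing

namespace QuadTime

/-! ### Recursively enumerable sets as halting sets of one-tape machines -/

/-- The positive number whose binary digits, least significant first, are `s` followed by a
leading `1`. Every string, with or without trailing zeros, has a number of its own. -/
def strPosNum : Str → PosNum
  | [] => PosNum.one
  | b :: s => cond b PosNum.bit1 PosNum.bit0 (strPosNum s)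

/-- `strPosNum` as a natural number. -/
def strNum (s : Str) : ℕ := (strPosNum s : ℕ)

theorem strPosNum_injective : Function.Injective strPosNum := by
  intro s
  induction s with
  | nil => intro t h; cases t with
    | nil => rfl
    | cons b t => cases b <;> simp [strPosNum] at h
  | cons b s ih => intro t h; cases t with
    | nil => cases b <;> simp [strPosNum] at h
    | cons c t =>
      cases b <;> cases c <;> simp [strPosNum] at h <;> rw [ih h]

theorem strNum_injective : Function.Injective strNum := fun _ _ h =>
  strPosNum_injective (PosNum.cast_inj.1 h)

theorem strNum_eq_foldr (s : Str) : strNum s = s.foldr (fun b n => 2 * n + b.toNat) 1 := by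
  induction s with
  | nil => rfl
  | cons b s ih =>
    rw [List.foldr_cons, ← ih]
    cases b <;> simp [strNum, strPosNum, PosNum.cast_bit0, PosNum.cast_bit1] <;> omega

/-- The stack symbol of a bit in Mathlib's stack machines for partial recursive functions. -/
def stackBit (b : Bool) : PartrecToTM2.Γ' := cond b .bit1 .bit0

theorem trList_strNum (s : Str) :
    PartrecToTM2.trList [strNum s] = s.map stackBit ++ [.bit1, .cons] := by
  have h : PartrecToTM2.trNat (strNum s) = s.map stackBit ++ [.bit1] := by
    rw [PartrecToTM2.trNat, strNum]
    have : ((strPosNum s : ℕ) : Num) = Num.pos (strPosNum s) := by simp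
    rw [this, PartrecToTM2.trNum]
    clear this
    induction s with
    | nil => rfl
    | cons b s ih =>
      cases b <;> simpa [strPosNum, PartrecToTM2.trPosNum, stackBit] using ih
  simp [PartrecToTM2.trList, h]

/-- A machine can be restricted to a finite set of states that supports it. -/
theorem TM0_restrict {Γ Λ : Type} [Inhabited Γ] [Inhabited Λ] (M : TM0.Machine Γ Λ) (S : Finset Λ)
    (hS : TM0.Supports M (S : Set Λ)) :
    ∃ (_ : Inhabited S) (M' : TM0.Machine Γ S), ∀ l, (TM0.eval M' l).Dom ↔ (TM0.eval M l).Dom := by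
  classical
  let i : Inhabited S := ⟨⟨default, hS.1⟩⟩
  let g₁ : PointedMap Λ S := ⟨fun q => if h : q ∈ S then ⟨q, h⟩ else default, by
    have : (default : Λ) ∈ S := hS.1
    simp [this]; rfl⟩
  have hg : ∀ q ∈ (S : Set Λ), ((g₁ q : S) : Λ) = q := fun q hq => by
    have : q ∈ S := hq
    show (((if h : q ∈ S then ⟨q, h⟩ else default : S)) : Λ) = q
    simp [this]
  refine ⟨i, TM0.Machine.map M ⟨id, rfl⟩ ⟨id, rfl⟩ g₁ Subtype.val, fun l => ?_⟩
  have := StateTransition.tr_eval_dom (TM0.Machine.map_respects M ⟨id, rfl⟩ ⟨id, rfl⟩ g₁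
    Subtype.val hS (fun _ => rfl) hg) (a₁ := TM0.init l) (a₂ := TM0.init l) ⟨hS.1, by
      rw [TM0.map_init]; congr; exact List.map_id l⟩
  exact this

theorem trInit_append_singleton {K : Type} [DecidableEq K] {Γ : K → Type} (k : K) (L : List (Γ k))
    (a : Γ k) :
    TM2to1.trInit k (L ++ [a]) = (true, Function.update (fun _ => none) k (some a)) ::
      L.reverse.map fun a => (false, Function.update (fun _ => none) k (some a)) := by
  unfold TM2to1.trInit
  rw [List.reverse_append]
  rfl

/-- A recursively enumerable set of numbers is the halting set of a Turing machine with one tape,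
finitely many states and a finite alphabet. The number of `s` is written on the tape from its
leading `1` down to its least significant digit, behind the mark `bot`: this is the bottom of the
main stack in Mathlib's translation of stack machines. -/
theorem exists_TM0_of_rePred (P : ℕ → Prop) (hP : REPred P) :
    ∃ (Λ Γ : Type) (_ : Inhabited Λ) (_ : Fintype Λ) (_ : Inhabited Γ) (_ : Fintype Γ)
      (M : TM0.Machine Γ Λ) (bit : Bool → Γ) (bot : Γ),
      ∀ s : Str, (TM0.eval M (bot :: bit true :: s.reverse.map bit)).Dom ↔ P (strNum s) := by
  classical
  have h1 : Partrec fun a => (Part.assert (P a) fun _ => Part.some ()).map fun _ => (0 : ℕ) :=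
    Partrec.map hP (Computable.const 0).to₂
  obtain ⟨c, hc⟩ := ToPartrec.Code.exists_code (Nat.Partrec'.part_iff₁.2 h1)
  have hdom : ∀ m, (c.eval [m]).Dom ↔ P m := fun m => by
    have := hc ⟨[m], rfl⟩
    simp only [] at this
    rw [this]
    simp [Part.assert, List.Vector.head]
  -- The initial state of Mathlib's stack machine for `c` is passed on as the default state.
  let iΛ : Inhabited PartrecToTM2.Λ' := ⟨PartrecToTM2.trNormal c PartrecToTM2.Cont'.halt⟩
  have hs2 := PartrecToTM2.tr_supports c PartrecToTM2.Cont'.halt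
  have hs1 := TM2to1.tr_supports PartrecToTM2.tr hs2
  have hs0 := TM1to0.tr_supports _ hs1
  obtain ⟨i, M', hM'⟩ := TM0_restrict _ _ hs0
  have iK : Fintype PartrecToTM2.K' :=
    ⟨{.main, .rev, .aux, .stack}, fun k => by cases k <;> simp⟩
  refine ⟨_, _, i, inferInstance, inferInstance, inferInstance, M',
    fun b => (false, Function.update (fun _ => none) PartrecToTM2.K'.main (some (stackBit b))),
    (true, Function.update (fun _ => none) PartrecToTM2.K'.main (some PartrecToTM2.Γ'.cons)),
    fun s => ?_⟩
  rw [hM', TM1to0.tr_eval]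
  have h2 := TM2to1.tr_eval_dom PartrecToTM2.tr PartrecToTM2.K'.main
    (PartrecToTM2.trList [strNum s])
  rw [← hdom (strNum s)]
  have h3 : (StateTransition.eval (TM2.step PartrecToTM2.tr)
      (PartrecToTM2.init c [strNum s])).Dom ↔ (c.eval [strNum s]).Dom := by
    rw [PartrecToTM2.tr_eval]; simp
  rw [← h3]
  have h4 : (TM2.eval PartrecToTM2.tr PartrecToTM2.K'.main
        (PartrecToTM2.trList [strNum s])).Dom ↔
      (StateTransition.eval (TM2.step PartrecToTM2.tr)
        (PartrecToTM2.init c [strNum s])).Dom := by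
    have : (TM2.init PartrecToTM2.K'.main (PartrecToTM2.trList [strNum s]) :
        PartrecToTM2.Cfg') = PartrecToTM2.init c [strNum s] := by
      simp only [TM2.init, PartrecToTM2.init]
      congr 1
      funext k; cases k <;> rfl
    rw [← this]
    rfl
  rw [← h4, ← h2, trList_strNum, ← List.singleton_append, ← List.append_assoc,
    trInit_append_singleton]
  have e : ∀ (f : PartrecToTM2.Γ' → TM2to1.Γ' PartrecToTM2.K' fun _ => PartrecToTM2.Γ'),
      (s.map stackBit ++ [PartrecToTM2.Γ'.bit1]).reverse.map f =
        f (stackBit true) :: s.reverse.map fun b => f (stackBit b) := by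
    intro f
    simp [stackBit, List.map_reverse, Function.comp_def]
  exact iff_of_eq (congrArg (fun l => (TM1.eval _ (_ :: l)).Dom)
    (e fun a => (false, Function.update (fun _ => none) PartrecToTM2.K'.main (some a))).symm)

/-! ### Step counts of partial transition functions -/

/-- The state reached by exactly `n` steps of the partial transition function `f`, if the process
lasts that long. -/
def stepN {σ : Type*} (f : σ → Option σ) : ℕ → σ → Option σ
  | 0, a => some a
  | n + 1, a => (f a).bind (stepN f n)

section stepN

variable {σ : Type*} {f : σ → Option σ} {a b c : σ} {m n : ℕ}

theorem stepN_add (f : σ → Option σ) (m n : ℕ) (a : σ) :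
    stepN f (m + n) a = (stepN f m a).bind (stepN f n) := by
  induction m generalizing a with
  | zero => simp [stepN]
  | succ m ih =>
    rw [Nat.succ_add, stepN, stepN]
    cases f a <;> simp [ih]

theorem stepN_one (f : σ → Option σ) (a : σ) : stepN f 1 a = f a := by
  rw [stepN]
  cases f a <;> rfl

theorem stepN_succ_right (f : σ → Option σ) (n : ℕ) (a : σ) :
    stepN f (n + 1) a = (stepN f n a).bind f := by
  rw [stepN_add]
  congr 1
  funext a
  exact stepN_one f a

theorem stepN_trans (h₁ : stepN f m a = some b) (h₂ : stepN f n b = some c) :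
    stepN f (m + n) a = some c := by
  rw [stepN_add, h₁, Option.bind_some, h₂]

theorem stepN_head (h₁ : f a = some b) (h₂ : stepN f n b = some c) :
    stepN f (n + 1) a = some c := by
  rw [stepN, h₁, Option.bind_some, h₂]

theorem stepN_tail (h₁ : stepN f n a = some b) (h₂ : f b = some c) :
    stepN f (n + 1) a = some c := by
  rw [stepN_succ_right, h₁, Option.bind_some, h₂]

theorem exists_stepN_iff_reaches : (∃ n, stepN f n a = some b) ↔ StateTransition.Reaches f a b := by
  constructor
  · rintro ⟨n, h⟩
    induction n generalizing b with
    | zero => cases h; exact Relation.ReflTransGen.refl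
    | succ n ih =>
      rw [stepN_succ_right, Option.bind_eq_some_iff] at h
      obtain ⟨c, hc, hb⟩ := h
      exact (ih hc).tail hb
  · intro h
    induction h with
    | refl => exact ⟨0, rfl⟩
    | tail _ h ih =>
      obtain ⟨n, hn⟩ := ih
      exact ⟨n + 1, stepN_tail hn h⟩

theorem eval_dom_iff_stepN :
    (StateTransition.eval f a).Dom ↔ ∃ n b, stepN f n a = some b ∧ f b = none := by
  rw [Part.dom_iff_mem, exists_comm]
  refine exists_congr fun b => ?_
  rw [StateTransition.mem_eval, ← exists_stepN_iff_reaches, exists_and_right]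

end stepN

/-- The one-tape machine `M`, started on `l`, carries out exactly `n` steps. -/
def HaltsAt {Γ Λ : Type} [Inhabited Γ] [Inhabited Λ] (M : TM0.Machine Γ Λ) (l : List Γ) (n : ℕ) :
    Prop :=
  ∃ c, stepN (TM0.step M) n (TM0.init l) = some c ∧ TM0.step M c = none

theorem TM0_eval_dom_iff {Γ Λ : Type} [Inhabited Γ] [Inhabited Λ] (M : TM0.Machine Γ Λ)
    (l : List Γ) : (TM0.eval M l).Dom ↔ ∃ n, HaltsAt M l n :=
  eval_dom_iff_stepN

/-! ### Tapes up to blanks -/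

section tapes

variable {α : Type} [Inhabited α]

@[simp] theorem mk₂_head_cons (L R : List α) (a : α) : (Turing.Tape.mk₂ L (a :: R)).head = a := rfl

@[simp] theorem mk₂_head_nil (L : List α) : (Turing.Tape.mk₂ L []).head = default := rfl

@[simp] theorem mk₂_move_right (L R : List α) (a : α) :
    (Turing.Tape.mk₂ L (a :: R)).move Dir.right = Turing.Tape.mk₂ (a :: L) R := by
  simp [Turing.Tape.mk₂, Turing.Tape.move_right_mk', ListBlank.cons_mk]

@[simp] theorem mk₂_move_left (L R : List α) (a : α) :
    (Turing.Tape.mk₂ (a :: L) R).move Dir.left = Turing.Tape.mk₂ L (a :: R) := by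
  simp [Turing.Tape.mk₂, Turing.Tape.move_left_mk', ListBlank.cons_mk]

@[simp] theorem mk₂_nil_move_left (R : List α) :
    (Turing.Tape.mk₂ [] R).move Dir.left = Turing.Tape.mk₂ [] (default :: R) := by
  simp [Turing.Tape.mk₂, Turing.Tape.move_left_mk', ListBlank.cons_mk]

@[simp] theorem mk₂_write_cons (L R : List α) (a b : α) :
    (Turing.Tape.mk₂ L (a :: R)).write b = Turing.Tape.mk₂ L (b :: R) := by
  rw [Turing.Tape.mk₂, Turing.Tape.write_mk']
  simp [Turing.Tape.mk₂, ListBlank.cons_mk]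

@[simp] theorem mk₂_write_nil (L : List α) (b : α) :
    (Turing.Tape.mk₂ L []).write b = Turing.Tape.mk₂ L [b] := by
  rw [Turing.Tape.mk₂, Turing.Tape.write_mk']
  simp [Turing.Tape.mk₂, ListBlank.cons_mk]

theorem mk₂_singleton_default (L : List α) :
    Turing.Tape.mk₂ L [default] = Turing.Tape.mk₂ L [] := by
  rw [← mk₂_write_nil, ← mk₂_head_nil L, Turing.Tape.write_self]

/-- The concrete tape `C` holds the symbols of the abstract tape `T`, coded by `e`. -/
def Represents (e : α → Sym) (T : Turing.Tape α) (C : Tape) : Prop :=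
  ∃ L R : List α, T = Turing.Tape.mk₂ L R ∧ C = (L.map e, R.map e)

/-- A move of the head of a tape, or none. -/
def moveOpt : Option Dir → Turing.Tape α → Turing.Tape α
  | none, T => T
  | some d, T => T.move d

/-- The moves of a head in the format of `Tape.move`. -/
def dirCode : Option Dir → Option Bool
  | none => none
  | some Dir.left => some false
  | some Dir.right => some true

theorem Represents.head {e : α → Sym} (he : e default = 0) {T : Turing.Tape α} {C : Tape}
    (h : Represents e T C) : C.head = e T.head := by
  obtain ⟨L, R, rfl, rfl⟩ := h
  cases R <;> simp [Tape.head, he]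

theorem Represents.write_move {e : α → Sym} (he : e default = 0) {T : Turing.Tape α} {C : Tape}
    (h : Represents e T C) (a : α) (d : Option Dir) :
    Represents e (moveOpt d (T.write a)) ((C.write (e a)).move (dirCode d)) := by
  obtain ⟨L, R, rfl, rfl⟩ := h
  have hw : (Turing.Tape.mk₂ L R).write a = Turing.Tape.mk₂ L (a :: R.tail) := by
    cases R <;> simp
  rw [hw]
  rcases d with _ | _ | _
  · exact ⟨L, a :: R.tail, rfl, by simp [dirCode, Tape.write, Tape.move]⟩
  · cases L with
    | nil => exact ⟨[], default :: a :: R.tail, by simp [moveOpt],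
        by simp [dirCode, Tape.write, Tape.move, he]⟩
    | cons b L => exact ⟨L, b :: a :: R.tail, by simp [moveOpt],
        by simp [dirCode, Tape.write, Tape.move]⟩
  · exact ⟨a :: L, R.tail, by simp [moveOpt], by simp [dirCode, Tape.write, Tape.move]⟩

theorem represents_map (e : α → Sym) (l : List α) :
    Represents e (Turing.Tape.mk₁ l) ([], l.map e) := ⟨[], l, rfl, rfl⟩

/-- The tape symbol of an abstract cell content. -/
def cellCode : Option Bool → Sym
  | none => 0
  | some b => bitSym b

theorem cellCode_injective : Function.Injective cellCode := by decide

theorem readBits_append_blank (l : List Sym) : readBits (l ++ [0]) = readBits l := by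
  fun_induction readBits l <;> simp_all [readBits]
  rename_i l h1 h2
  rcases l with _ | ⟨a, l⟩
  · rfl
  · match a with
    | 0 => rfl
    | 1 => simp at h1
    | 2 => simp at h2
    | a + 3 => rfl

theorem readBits_append_blanks (l : List Sym) (n : ℕ) :
    readBits (l ++ List.replicate n 0) = readBits l := by
  induction n with
  | zero => simp
  | succ n ih => rw [List.replicate_succ', ← List.append_assoc, readBits_append_blank, ih]

theorem readBits_map_bitSym (s : Str) : readBits (s.map bitSym) = s := by
  induction s with
  | nil => rfl
  | cons b s ih => cases b <;> simp [bitSym, readBits, ih]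

/-- Trailing blanks on the output tape do not matter. -/
theorem readBits_congr {l l' : List Sym} (h : ListBlank.mk l = ListBlank.mk l') :
    readBits l = readBits l' := by
  have key : ∀ {l l' : List Sym}, BlankExtends l l' → readBits l = readBits l' := by
    rintro l _ ⟨n, rfl⟩
    exact (readBits_append_blanks _ n).symm
  rcases Quotient.exact h with h | h
  · exact key h
  · exact (key h).symm

theorem Represents.readBits {L : List (Option Bool)} {s : Str} {C : Tape}
    (h : Represents cellCode (Turing.Tape.mk₂ L (s.map some)) C) : readBits C.2 = s := by
  obtain ⟨L', R, h, rfl⟩ := h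
  have h' : ListBlank.mk (s.map some) = ListBlank.mk R := by
    have := congrArg Turing.Tape.right₀ h
    simpa [Turing.Tape.mk₂] using this
  have h'' : ListBlank.mk ((s.map some).map cellCode) = ListBlank.mk (R.map cellCode) := by
    have := congrArg (ListBlank.map (⟨cellCode, rfl⟩ : PointedMap (Option Bool) Sym)) h'
    rwa [ListBlank.map_mk, ListBlank.map_mk] at this
  rw [← readBits_congr h'', List.map_map]
  exact readBits_map_bitSym s

end tapes

/-! ### Two-input machines with one work tape -/

/-- What a machine does in one step: the new contents of the scanned cells of the output tape and of
the work tape, the moves of the four heads and the next state. The input tapes are read-only. -/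
structure Act (Q Γ : Type) where
  out : Option Bool
  outMove : Option Dir
  fstMove : Option Dir
  sndMove : Option Dir
  work : Γ
  workMove : Option Dir
  next : Q

/-- A transition function for a machine with an output tape, two input tapes and one work tape with
alphabet `Γ`: its arguments are the state and the symbols on the output tape, on the two input tapes
and on the work tape. -/
abbrev Trans (Q Γ : Type) := Q → Option Bool → Option Bool → Option Bool → Γ → Option (Act Q Γ)

/-- A configuration, with tapes up to blanks: the state, the output tape, the input tapes and the
work tape. -/
structure ACfg (Q Γ : Type) [Inhabited Γ] where
  state : Q
  out : Turing.Tape (Option Bool)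
  fst : Turing.Tape (Option Bool)
  snd : Turing.Tape (Option Bool)
  work : Turing.Tape Γ

section compile

variable {Q Γ : Type} [Inhabited Γ]

/-- One step with the transition function `δ`; there is none if the machine halts. -/
def Trans.step (δ : Trans Q Γ) (c : ACfg Q Γ) : Option (ACfg Q Γ) :=
  (δ c.state c.out.head c.fst.head c.snd.head c.work.head).map fun r =>
    ⟨r.next, moveOpt r.outMove (c.out.write r.out), moveOpt r.fstMove c.fst,
      moveOpt r.sndMove c.snd, moveOpt r.workMove (c.work.write r.work)⟩

/-- The initial configuration with state `q` and inputs `w` and `v`. -/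
def ACfg.init (Γ : Type) [Inhabited Γ] (q : Q) (w v : Str) : ACfg Q Γ :=
  ⟨q, Turing.Tape.mk₁ [], Turing.Tape.mk₁ (w.map some), Turing.Tape.mk₁ (v.map some),
    Turing.Tape.mk₁ []⟩

/-- The instruction for one value of a transition function, with states and work symbols coded by
`eQ` and `eΓ`. -/
def toInstr (eQ : Q → ℕ) (eΓ : Γ → Sym) (q : Q) (o a b : Option Bool) (z : Γ) (r : Act Q Γ) :
    Instr :=
  (eQ q, [(cellCode o, cellCode r.out, dirCode r.outMove),
    (cellCode a, cellCode a, dirCode r.fstMove), (cellCode b, cellCode b, dirCode r.sndMove),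
    (eΓ z, eΓ r.work, dirCode r.workMove)], eQ r.next)

open Classical in
/-- The machine with transition function `δ`. -/
noncomputable def Trans.machine [Fintype Q] [Fintype Γ] (δ : Trans Q Γ) (eQ : Q → ℕ)
    (eΓ : Γ → Sym) : Machine :=
  (1, (Finset.univ : Finset (Q × Option Bool × Option Bool × Option Bool × Γ)).toList.filterMap
    fun x => (δ x.1 x.2.1 x.2.2.1 x.2.2.2.1 x.2.2.2.2).map
      (toInstr eQ eΓ x.1 x.2.1 x.2.2.1 x.2.2.2.1 x.2.2.2.2))

/-- The concrete configuration `C` is coded by the abstract one `c`. -/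
def RepresentsCfg (eQ : Q → ℕ) (eΓ : Γ → Sym) (c : ACfg Q Γ) (C : Config) : Prop :=
  ∃ To Tw Tv Tz, C = (eQ c.state, [To, Tw, Tv, Tz]) ∧ Represents cellCode c.out To ∧
    Represents cellCode c.fst Tw ∧ Represents cellCode c.snd Tv ∧ Represents eΓ c.work Tz

variable [Fintype Q] [Fintype Γ] {δ : Trans Q Γ} {eQ : Q → ℕ} {eΓ : Γ → Sym}

omit [Inhabited Γ] in
theorem Trans.mem_machine {I : Instr} : I ∈ (δ.machine eQ eΓ).2 ↔
    ∃ q o a b z r, δ q o a b z = some r ∧ I = toInstr eQ eΓ q o a b z r := by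
  simp only [Trans.machine, List.mem_filterMap, Finset.mem_toList, Finset.mem_univ, true_and,
    Prod.exists, Option.map_eq_some_iff]
  simp only [eq_comm (a := I)]

variable (hQ : Function.Injective eQ) (hΓ : Function.Injective eΓ) (h0 : eΓ default = 0)
include hQ hΓ h0

theorem RepresentsCfg.instr? {c : ACfg Q Γ} {C : Config} (h : RepresentsCfg eQ eΓ c C) :
    (δ.machine eQ eΓ).instr? C =
      (δ c.state c.out.head c.fst.head c.snd.head c.work.head).map
        (toInstr eQ eΓ c.state c.out.head c.fst.head c.snd.head c.work.head) := by
  obtain ⟨To, Tw, Tv, Tz, rfl, ho, hw, hv, hz⟩ := h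
  have fits : ∀ q o a b z r, (toInstr eQ eΓ q o a b z r).1 = eQ c.state ∧
      (toInstr eQ eΓ q o a b z r).2.1.map (fun a => a.1) = [To, Tw, Tv, Tz].map Tape.head ↔
      q = c.state ∧ o = c.out.head ∧ a = c.fst.head ∧ b = c.snd.head ∧ z = c.work.head := by
    intro q o a b z r
    simp [toInstr, ho.head rfl, hw.head rfl, hv.head rfl, hz.head h0, hQ.eq_iff, hΓ.eq_iff,
      cellCode_injective.eq_iff]
  cases hδ : δ c.state c.out.head c.fst.head c.snd.head c.work.head with
  | none =>
    rw [Option.map_none, Machine.instr?, List.find?_eq_none]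
    intro I hI
    obtain ⟨q, o, a, b, z, r, hr, rfl⟩ := Trans.mem_machine.1 hI
    rw [decide_eq_true_iff, fits]
    rintro ⟨rfl, rfl, rfl, rfl, rfl⟩
    simp [hδ] at hr
  | some r =>
    rw [Option.map_some]
    have hmem : toInstr eQ eΓ c.state c.out.head c.fst.head c.snd.head c.work.head r ∈
        (δ.machine eQ eΓ).2 := Trans.mem_machine.2 ⟨_, _, _, _, _, r, hδ, rfl⟩
    cases hf : (δ.machine eQ eΓ).instr? (eQ c.state, [To, Tw, Tv, Tz]) with
    | none =>
      rw [Machine.instr?, List.find?_eq_none] at hf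
      exact absurd (decide_eq_true ((fits _ _ _ _ _ _).2 ⟨rfl, rfl, rfl, rfl, rfl⟩)) (hf _ hmem)
    | some I =>
      obtain ⟨q, o, a, b, z, r', hr, rfl⟩ := Trans.mem_machine.1 (List.mem_of_find?_eq_some hf)
      have := List.find?_some hf
      rw [decide_eq_true_iff, fits] at this
      obtain ⟨rfl, rfl, rfl, rfl, rfl⟩ := this
      rw [hδ] at hr
      cases hr
      rfl

theorem RepresentsCfg.step {c c' : ACfg Q Γ} {C : Config} (h : RepresentsCfg eQ eΓ c C)
    (hc : δ.step c = some c') : RepresentsCfg eQ eΓ c' ((δ.machine eQ eΓ).step C) := by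
  rw [Trans.step, Option.map_eq_some_iff] at hc
  obtain ⟨r, hr, rfl⟩ := hc
  have hi := h.instr? (δ := δ) hQ hΓ h0
  rw [hr, Option.map_some] at hi
  rw [Machine.step, hi]
  obtain ⟨To, Tw, Tv, Tz, rfl, ho, hw, hv, hz⟩ := h
  refine ⟨_, _, _, _, rfl, ho.write_move rfl _ _, ?_, ?_, hz.write_move h0 _ _⟩
  · simpa [Turing.Tape.write_self] using hw.write_move rfl c.fst.head r.fstMove
  · simpa [Turing.Tape.write_self] using hv.write_move rfl c.snd.head r.sndMove

theorem RepresentsCfg.halted {c : ACfg Q Γ} {C : Config} (h : RepresentsCfg eQ eΓ c C)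
    (hc : δ.step c = none) : (δ.machine eQ eΓ).Halted C := by
  rw [Trans.step, Option.map_eq_none_iff] at hc
  rw [Machine.Halted, h.instr? hQ hΓ h0, hc, Option.map_none]

theorem Trans.representsCfg_run {q : Q} (hq : eQ q = 0) {w v : Str} {n : ℕ} {c : ACfg Q Γ}
    (h : stepN δ.step n (ACfg.init Γ q w v) = some c) :
    RepresentsCfg eQ eΓ c ((δ.machine eQ eΓ).run [w, v] n) := by
  induction n generalizing c with
  | zero =>
    cases h
    refine ⟨_, _, _, _, ?_, represents_map _ _, represents_map _ _, represents_map _ _,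
      represents_map _ _⟩
    simp [ACfg.init, hq, Machine.run, Machine.init, Trans.machine, Tape.ofStr, Tape.blank,
      Function.comp_def, cellCode]
  | succ n ih =>
    rw [stepN_succ_right, Option.bind_eq_some_iff] at h
    obtain ⟨d, hd, hc⟩ := h
    rw [Machine.run, Function.iterate_succ_apply']
    exact (ih hd).step hQ hΓ h0 hc

end compile

theorem exists_code_nat (α : Type) [Finite α] (a : α) :
    ∃ e : α → ℕ, Function.Injective e ∧ e a = 0 := by
  obtain ⟨e, he⟩ := Countable.exists_injective_nat α
  exact ⟨Equiv.swap (e a) 0 ∘ e, (Equiv.injective _).comp he, by simp⟩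

/-! ### The machine that checks a certificate and looks up a value -/

section lookupMachine

/-- States of the checking phase. In `pair₁` and `pair₂ c` the machine copies the pairs of bits of
the second input to the work tape, up to and including the first pair `00`, where `c` is the first
bit of the current pair; in `lead` and `bottom` it completes the input of the simulated machine,
which it then runs in the states `sim q`. -/
inductive CheckState (Λ : Type)
  | pair₁
  | pair₂ (c : Bool)
  | lead
  | bottom
  | sim (q : Λ)

/-- States of the lookup phase. After rewinding the second input, the machine compares the flags of
the current blocks in `flag₁` and `flag₂`. In `skip k c` it passes over fields, where `k` tells
which field it is in and what to do next, and in `copy t c` it writes a field to the output, from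
the second input if `t = true` and from the first one otherwise. In both, `c` is the first bit of
the current pair, once it has been read. -/
inductive LookupState
  | rewind
  | flag₁
  | flag₂
  | skip (k : Fin 5) (c : Option Bool)
  | copy (t : Bool) (c : Option Bool)
  | done

variable {Λ Γ : Type} [Inhabited Λ] [Inhabited Γ]

/-- The checking phase when the second input shows the bit `b`, and the work tape the symbol `z`:
the symbol to write on the work tape, the move of its head and the next state. The head of the
second input moves right each time, and each step of the simulated machine uses up one bit `0`. -/
def checkTrans (M : TM0.Machine Γ Λ) (bit : Bool → Γ) (bot : Γ) :
    CheckState Λ → Bool → Γ → Option (Γ × Option Dir × CheckState Λ)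
  | .pair₁, b, _ => some (bit b, some Dir.left, .pair₂ b)
  | .pair₂ c, b, _ => some (bit b, some Dir.left, cond (c || b) .pair₁ .lead)
  | .lead, false, _ => some (bit true, some Dir.left, .bottom)
  | .bottom, false, _ => some (bot, none, .sim default)
  | .sim q, false, z => (M q z).map fun r => match r.2 with
    | .write y => (y, none, .sim r.1)
    | .move d => (z, some d, .sim r.1)
  | _, true, _ => none

/-- The moves of the heads of the first and second input for reading on the second one (`t = true`)
or the first one (`t = false`), a new output symbol and move, and the next state. -/
def readOn {Q : Type} (t : Bool) (o : Option Bool) (mo : Option Dir) (q : Q) :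
    Option (Option Bool × Option Dir × Option Dir × Option Dir × Q) :=
  some (o, mo, cond t none (some Dir.right), cond t (some Dir.right) none, q)

/-- The state after the end of a field in state `skip k`. The fields that remain to be skipped are:
for `k = 4`, both fields of the block of the second input and then both fields of the block of the
first input, and so on down to `k = 1`, before the next pair of blocks is looked at; for `k = 0`,
the first field in the block of the first input, before the second one is copied. -/
def skipNext : Fin 5 → LookupState
  | 0 => .copy false none
  | 1 => .flag₁
  | 2 => .skip 1 none
  | 3 => .skip 2 none
  | 4 => .skip 3 none

/-- The lookup phase: the new output symbol, the moves of the heads on the output tape and the two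
input tapes, and the next state. Values are stored from the most to the least significant bit, and
are written from right to left. -/
def lookupTrans : LookupState → Option Bool → Option Bool → Option Bool →
    Option (Option Bool × Option Dir × Option Dir × Option Dir × LookupState)
  | .rewind, o, _, some _ => some (o, none, none, some Dir.left, .rewind)
  | .rewind, o, _, none => some (o, none, none, some Dir.right, .flag₁)
  | .flag₁, o, some _, some _ => some (o, none, some Dir.right, some Dir.right, .flag₂)
  | .flag₂, o, some true, some _ => readOn true o none (.copy true none)
  | .flag₂, o, some false, some true => readOn false o none (.skip 0 none)
  | .flag₂, o, some false, some false =>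
    some (o, none, some Dir.right, some Dir.right, .skip 4 none)
  | .skip k c, o, a, b =>
    match c, cond (decide (3 ≤ k)) b a with
    | none, some y => readOn (decide (3 ≤ k)) o none (.skip k (some y))
    | some true, some _ => readOn (decide (3 ≤ k)) o none (.skip k none)
    | some false, some true => readOn (decide (3 ≤ k)) o none (skipNext k)
    | _, _ => none
  | .copy t c, o, a, b =>
    match c, cond t b a with
    | none, some y => readOn t o none (.copy t (some y))
    | some true, some y => readOn t (some y) (some Dir.left) (.copy t none)
    | some false, some true => readOn t o (some Dir.right) .done
    | _, _ => none
  | _, _, _, _ => none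

/-- The transition function of the whole machine: the lookup begins when the simulated machine halts
exactly at the end of the second input. -/
def lookupMachine (M : TM0.Machine Γ Λ) (bit : Bool → Γ) (bot : Γ) :
    Trans (CheckState Λ ⊕ LookupState) Γ
  | .inl q, o, _, some b, z => (checkTrans M bit bot q b z).map fun r =>
      ⟨o, none, none, some Dir.right, r.1, r.2.1, .inl r.2.2⟩
  | .inl (.sim q), o, _, none, z =>
      if (M q z).isNone then some ⟨o, none, none, some Dir.left, z, none, .inr .rewind⟩ else none
  | .inl _, _, _, none, _ => none
  | .inr q, o, a, b, z => (lookupTrans q o a b).map fun r =>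
      ⟨r.1, r.2.1, r.2.2.1, r.2.2.2.1, z, none, .inr r.2.2.2.2⟩

instance [Finite Λ] : Finite (CheckState Λ) := by
  let f : CheckState Λ → Option Λ × Fin 5 := fun
    | .pair₁ => (none, 0)
    | .pair₂ false => (none, 1)
    | .pair₂ true => (none, 2)
    | .lead => (none, 3)
    | .bottom => (none, 4)
    | .sim q => (some q, 0)
  refine Finite.of_injective f ?_
  rintro (_ | (_ | _) | _ | _ | q) (_ | (_ | _) | _ | _ | q') h <;> simp_all [f]

instance : Finite LookupState := by
  let f : LookupState → Fin 5 × Option Bool × Fin 7 := fun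
    | .rewind => (0, none, 0)
    | .flag₁ => (0, none, 1)
    | .flag₂ => (0, none, 2)
    | .skip k c => (k, c, 3)
    | .copy false c => (0, c, 4)
    | .copy true c => (0, c, 5)
    | .done => (0, none, 6)
  refine Finite.of_injective f ?_
  rintro (_ | _ | _ | ⟨k, c⟩ | ⟨_ | _, c⟩ | _) (_ | _ | _ | ⟨k', c'⟩ | ⟨_ | _, c'⟩ | _) h <;>
    simp_all [f]

end lookupMachine

/-! ### The checking phase -/

section check

variable {Λ Γ : Type} [Inhabited Λ] [Inhabited Γ]
variable (M : TM0.Machine Γ Λ) (bit : Bool → Γ) (bot : Γ)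

/-- One step of the checking phase, on a bit `b` of the second input. -/
def checkStep (x : CheckState Λ × Turing.Tape Γ) (b : Bool) :
    Option (CheckState Λ × Turing.Tape Γ) :=
  (checkTrans M bit bot x.1 b x.2.head).map fun r => (r.2.2, moveOpt r.2.1 (x.2.write r.1))

/-- The state and the work tape after the checking phase has read the string `s`, unless the machine
has halted. -/
def scan (s : Str) : Option (CheckState Λ × Turing.Tape Γ) :=
  s.foldl (fun x b => x.bind fun y => checkStep M bit bot y b)
    (some (.pair₁, Turing.Tape.mk₁ []))

/-- The string is accepted: the simulated machine halts exactly at the end. -/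
def Accepts (v : Str) : Prop :=
  ∃ q T, scan M bit bot v = some (.sim q, T) ∧ M q T.head = none

/-- The configuration of the checking phase in which the part `s` of the second input has been read
and the part `rest` is left. -/
def checkCfg (w s rest : Str) (x : CheckState Λ × Turing.Tape Γ) :
    ACfg (CheckState Λ ⊕ LookupState) Γ :=
  ⟨.inl x.1, Turing.Tape.mk₁ [], Turing.Tape.mk₁ (w.map some),
    Turing.Tape.mk₂ (s.reverse.map some) (rest.map some), x.2⟩

variable {M bit bot}

theorem scan_concat (s : Str) (b : Bool) : scan M bit bot (s ++ [b]) =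
    (scan M bit bot s).bind fun y => checkStep M bit bot y b := by
  simp [scan]

theorem step_checkCfg (w s rest : Str) (b : Bool) (x : CheckState Λ × Turing.Tape Γ) :
    (lookupMachine M bit bot).step (checkCfg w s (b :: rest) x) =
      (checkStep M bit bot x b).map (checkCfg w (s ++ [b]) rest) := by
  obtain ⟨q, T⟩ := x
  simp only [Trans.step, checkCfg, checkStep, List.map_cons, mk₂_head_cons, lookupMachine,
    Option.map_map]
  congr 1
  funext r
  simp only [Function.comp_apply, checkCfg, moveOpt, mk₂_move_right, Turing.Tape.write_self,
    List.reverse_append, List.reverse_cons, List.reverse_nil, List.nil_append, List.cons_append,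
    List.map_cons]

theorem stepN_checkCfg {w s : Str} (rest : Str) {x : CheckState Λ × Turing.Tape Γ}
    (h : scan M bit bot s = some x) :
    stepN (lookupMachine M bit bot).step s.length (ACfg.init Γ (.inl .pair₁) w (s ++ rest)) =
      some (checkCfg w s rest x) := by
  induction s using List.reverseRecOn generalizing rest x with
  | nil => cases h; rfl
  | append_singleton s b ih =>
    rw [scan_concat, Option.bind_eq_some_iff] at h
    obtain ⟨y, hy, hx⟩ := h
    rw [List.length_append, List.length_singleton, stepN_succ_right, List.append_assoc,
      List.singleton_append, ih (b :: rest) hy, Option.bind_some, step_checkCfg, hx,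
      Option.map_some]

/-- A string that is not accepted makes the machine halt during the checking phase. -/
theorem halt_of_not_accepts {v : Str} (hv : ¬ Accepts M bit bot v) (w : Str) :
    ∃ n ≤ v.length, ∃ s rest x, stepN (lookupMachine M bit bot).step n
      (ACfg.init Γ (.inl .pair₁) w v) = some (checkCfg w s rest x) ∧
      (lookupMachine M bit bot).step (checkCfg w s rest x) = none := by
  have key : ∀ s rest, (∃ x, scan M bit bot s = some x) ∨ ∃ n ≤ s.length, ∃ s' rest' x,
      stepN (lookupMachine M bit bot).step n (ACfg.init Γ (.inl .pair₁) w (s ++ rest)) =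
        some (checkCfg w s' rest' x) ∧
      (lookupMachine M bit bot).step (checkCfg w s' rest' x) = none := by
    intro s
    induction s using List.reverseRecOn with
    | nil => exact fun _ => Or.inl ⟨_, rfl⟩
    | append_singleton s b ih =>
      intro rest
      rcases ih (b :: rest) with ⟨x, hx⟩ | ⟨n, hn, s', rest', x, h⟩
      · cases hc : checkStep M bit bot x b with
        | none =>
          refine Or.inr ⟨s.length, by simp, s, b :: rest, x, ?_, ?_⟩
          · rw [List.append_assoc, List.singleton_append]
            exact stepN_checkCfg _ hx
          · rw [step_checkCfg, hc, Option.map_none]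
        | some y => exact Or.inl ⟨y, by rw [scan_concat, hx, Option.bind_some, hc]⟩
      · refine Or.inr ⟨n, by simp; omega, s', rest', x, ?_, h.2⟩
        rw [List.append_assoc, List.singleton_append]
        exact h.1
  rcases key v [] with ⟨x, hx⟩ | h
  · refine ⟨v.length, le_rfl, v, [], x, ?_, ?_⟩
    · simpa using stepN_checkCfg (w := w) [] hx
    · obtain ⟨q, T⟩ := x
      rw [Trans.step, Option.map_eq_none_iff]
      cases q with
      | sim q =>
        have : (M q T.head).isNone = false := by
          by_contra hc
          exact hv ⟨q, T, hx, by simpa using hc⟩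
        simp only [checkCfg, List.map_nil, mk₂_head_nil, Option.default_eq_none, lookupMachine,
          this]
        rfl
      | _ => rfl
  · simpa using h

/-- An accepted string brings the machine to the lookup phase. -/
theorem stepN_of_accepts {v : Str} (hv : Accepts M bit bot v) (w : Str) :
    ∃ T, stepN (lookupMachine M bit bot).step (v.length + 1) (ACfg.init Γ (.inl .pair₁) w v) =
      some ⟨.inr .rewind, Turing.Tape.mk₁ [], Turing.Tape.mk₁ (w.map some),
        (Turing.Tape.mk₂ (v.reverse.map some) []).move Dir.left, T⟩ := by
  obtain ⟨q, T, h, hq⟩ := hv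
  refine ⟨T, ?_⟩
  have := stepN_checkCfg (w := w) [] h
  rw [List.append_nil] at this
  rw [stepN_succ_right, this, Option.bind_some]
  simp only [Trans.step, checkCfg, List.map_nil, mk₂_head_nil, Option.default_eq_none,
    lookupMachine, hq, Option.isNone_none, if_true, Option.map_some, moveOpt,
    Turing.Tape.write_self]

/-- The input of the simulated machine for the string `s`, the number of which is `strNum s`. -/
def simInput (bit : Bool → Γ) (bot : Γ) (s : Str) : List Γ :=
  bot :: bit true :: s.reverse.map bit

theorem mk₁_move_left_write (l : List Γ) (a : Γ) :
    ((Turing.Tape.mk₁ l).move Dir.left).write a = Turing.Tape.mk₁ (a :: l) := by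
  simp [Turing.Tape.mk₁]

theorem checkStep_sim (q : Λ) (T : Turing.Tape Γ) :
    checkStep M bit bot (.sim q, T) false =
      (TM0.step M ⟨q, T⟩).map fun c => (.sim c.q, c.Tape) := by
  simp only [checkStep, checkTrans, TM0.step, Option.map_map]
  congr 1
  funext ⟨q', s⟩
  cases s <;> simp [moveOpt, Turing.Tape.write_self]

/-- The meaning of the states of the checking phase: what the string `v` that has been read and the
work tape `T` look like in each state. -/
def ScanSpec (M : TM0.Machine Γ Λ) (bit : Bool → Γ) (bot : Γ) (v : Str) (T : Turing.Tape Γ) :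
    CheckState Λ → Prop
  | .pair₁ => T = (Turing.Tape.mk₁ (v.reverse.map bit)).move Dir.left
  | .pair₂ c => T = (Turing.Tape.mk₁ (v.reverse.map bit)).move Dir.left ∧ ∃ s, v = s ++ [c]
  | .lead => T = (Turing.Tape.mk₁ (v.reverse.map bit)).move Dir.left ∧ ∃ s, v = s ++ [false, false]
  | .bottom => ∃ s, v = s ++ [false, false] ++ [false] ∧
      T = (Turing.Tape.mk₁ (bit true :: (s ++ [false, false]).reverse.map bit)).move Dir.left
  | .sim q => ∃ s n, v = s ++ [false, false] ++ [false, false] ++ List.replicate n false ∧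
      stepN (TM0.step M) n (TM0.init (simInput bit bot (s ++ [false, false]))) = some ⟨q, T⟩

theorem scanSpec_of_scan {v : Str} {q : CheckState Λ} {T : Turing.Tape Γ}
    (h : scan M bit bot v = some (q, T)) : ScanSpec M bit bot v T q := by
  induction v using List.reverseRecOn generalizing q T with
  | nil =>
    cases h
    simp [ScanSpec, Turing.Tape.mk₁, mk₂_singleton_default]
  | append_singleton v b ih =>
    rw [scan_concat, Option.bind_eq_some_iff] at h
    obtain ⟨⟨q', T'⟩, hy, hx⟩ := h
    have ih := ih hy
    cases q' with
    | pair₁ =>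
      simp only [checkStep, checkTrans, Option.map_some, Option.some.injEq, Prod.mk.injEq,
        ScanSpec] at hx ih
      obtain ⟨rfl, rfl⟩ := hx
      subst ih
      simp [ScanSpec, moveOpt, mk₁_move_left_write]
    | pair₂ c =>
      simp only [checkStep, checkTrans, Option.map_some, Option.some.injEq, Prod.mk.injEq,
        ScanSpec] at hx ih
      obtain ⟨rfl, rfl⟩ := hx
      obtain ⟨rfl, s, rfl⟩ := ih
      cases c <;> cases b <;> simp [ScanSpec, moveOpt, mk₁_move_left_write]
    | lead =>
      obtain ⟨rfl, s, rfl⟩ := ih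
      cases b with
      | true => simp [checkStep, checkTrans] at hx
      | false =>
        simp only [checkStep, checkTrans, Option.map_some, Option.some.injEq, Prod.mk.injEq] at hx
        obtain ⟨rfl, rfl⟩ := hx
        exact ⟨s, rfl, by rw [mk₁_move_left_write]; rfl⟩
    | bottom =>
      obtain ⟨s, rfl, rfl⟩ := ih
      cases b with
      | true => simp [checkStep, checkTrans] at hx
      | false =>
        simp only [checkStep, checkTrans, Option.map_some, Option.some.injEq, Prod.mk.injEq] at hx
        obtain ⟨rfl, rfl⟩ := hx
        refine ⟨s, 0, by simp, ?_⟩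
        rw [mk₁_move_left_write]
        rfl
    | sim q' =>
      obtain ⟨s, n, rfl, hn⟩ := ih
      cases b with
      | true => simp [checkStep, checkTrans] at hx
      | false =>
        rw [checkStep_sim, Option.map_eq_some_iff] at hx
        obtain ⟨c, hc, hx⟩ := hx
        cases hx
        refine ⟨s, n + 1, ?_, stepN_tail hn hc⟩
        rw [List.replicate_succ', List.append_assoc _ (List.replicate n false)]

/-- A string is a sequence of pairs of bits other than `00`. -/
inductive PairCode : Str → Prop
  | nil : PairCode []
  | concat {s : Str} (h : PairCode s) (c b : Bool) (hcb : (c || b) = true) :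
    PairCode (s ++ [c, b])

theorem PairCode.append {s t : Str} (hs : PairCode s) (ht : PairCode t) : PairCode (s ++ t) := by
  induction ht with
  | nil => simpa
  | concat _ c b hcb ih => rw [← List.append_assoc]; exact ih.concat c b hcb

theorem PairCode.scan_eq {s : Str} (hs : PairCode s) :
    ∃ T, scan M bit bot s = some (.pair₁, T) := by
  induction hs with
  | nil => exact ⟨_, rfl⟩
  | @concat s _ c b hcb ih =>
    obtain ⟨T, hT⟩ := ih
    rw [← List.singleton_append, ← List.append_assoc, scan_concat, scan_concat, hT]
    simp [checkStep, checkTrans, hcb]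

theorem PairCode.scan_sim {s : Str} (hs : PairCode s) {n : ℕ} {c : TM0.Cfg Γ Λ}
    (hc : stepN (TM0.step M) n (TM0.init (simInput bit bot (s ++ [false, false]))) = some c) :
    scan M bit bot (s ++ [false, false] ++ [false, false] ++ List.replicate n false) =
      some (.sim c.q, c.Tape) := by
  induction n generalizing c with
  | zero =>
    cases hc
    obtain ⟨T, hT⟩ := hs.scan_eq (M := M) (bit := bit) (bot := bot)
    have e : ∀ t : Str, t ++ [false, false] = (t ++ [false]) ++ [false] := by simp
    have h1 : ∃ T', scan M bit bot (s ++ [false, false]) = some (.lead, T') := by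
      rw [e, scan_concat, scan_concat, hT]
      exact ⟨_, rfl⟩
    obtain ⟨T', hT'⟩ := h1
    have hspec := (scanSpec_of_scan hT').1
    rw [List.replicate_zero, List.append_nil, e, scan_concat, scan_concat, hT', hspec]
    simp only [Option.bind_some, checkStep, checkTrans, Option.map_some, moveOpt,
      mk₁_move_left_write]
    rfl
  | succ n ih =>
    rw [stepN_succ_right, Option.bind_eq_some_iff] at hc
    obtain ⟨d, hd, hc⟩ := hc
    rw [List.replicate_succ', ← List.append_assoc, scan_concat, ih hd, Option.bind_some,
      checkStep_sim]
    exact congrArg (Option.map _) hc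

theorem Accepts.exists_haltsAt {v : Str} (hv : Accepts M bit bot v) :
    ∃ s n, v = s ++ [false, false] ++ [false, false] ++ List.replicate n false ∧
      HaltsAt M (simInput bit bot (s ++ [false, false])) n := by
  obtain ⟨q, T, h, hq⟩ := hv
  obtain ⟨s, n, hs, hn⟩ := scanSpec_of_scan h
  exact ⟨s, n, hs, _, hn, by simp [TM0.step, hq]⟩

theorem PairCode.accepts {s : Str} (hs : PairCode s) {n : ℕ}
    (hn : HaltsAt M (simInput bit bot (s ++ [false, false])) n) :
    Accepts M bit bot (s ++ [false, false] ++ [false, false] ++ List.replicate n false) := by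
  obtain ⟨c, hc, hc'⟩ := hn
  exact ⟨c.q, c.Tape, hs.scan_sim hc, by simpa [TM0.step] using hc'⟩

end check

/-! ### The lookup phase -/

section lookup

variable {Λ Γ : Type} [Inhabited Λ] [Inhabited Γ]
variable {M : TM0.Machine Γ Λ} {bit : Bool → Γ} {bot : Γ}

theorem step_lookup (q : LookupState) (o Tw Tv : Turing.Tape (Option Bool)) (z : Turing.Tape Γ) :
    (lookupMachine M bit bot).step ⟨.inr q, o, Tw, Tv, z⟩ =
      (lookupTrans q o.head Tw.head Tv.head).map fun r =>
        ⟨.inr r.2.2.2.2, moveOpt r.2.1 (o.write r.1), moveOpt r.2.2.1 Tw,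
          moveOpt r.2.2.2.1 Tv, z⟩ := by
  simp only [Trans.step, lookupMachine, Option.map_map, Function.comp_def, moveOpt,
    Turing.Tape.write_self]

theorem skipNext_ne_rewind (k : Fin 5) : skipNext k ≠ .rewind := by
  fin_cases k <;> simp [skipNext]

/-- After the rewinding, every step moves the heads of one or both inputs to the right, away from
cells that are not blank. -/
theorem lookupTrans_moves {q q' : LookupState} (hq : q ≠ .rewind) {o a b o' : Option Bool}
    {mo ma mb : Option Dir} (h : lookupTrans q o a b = some (o', mo, ma, mb, q')) :
    q' ≠ .rewind ∧ (ma = some Dir.right ∧ a ≠ none ∧ mb = none ∨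
      ma = none ∧ mb = some Dir.right ∧ b ≠ none ∨
      ma = some Dir.right ∧ a ≠ none ∧ mb = some Dir.right ∧ b ≠ none) := by
  rcases q with _ | _ | _ | ⟨k, c⟩ | ⟨t, c⟩ | _
  · exact absurd rfl hq
  · rcases a with _ | a <;> rcases b with _ | b <;> simp [lookupTrans] at h
    obtain ⟨-, -, rfl, rfl, rfl⟩ := h
    simp
  · rcases a with _ | _ | _ <;> rcases b with _ | _ | _ <;> simp [lookupTrans, readOn] at h <;>
    · obtain ⟨-, -, rfl, rfl, rfl⟩ := h
      simp
  · have hk := skipNext_ne_rewind k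
    simp only [lookupTrans] at h
    generalize decide (3 ≤ k) = t at h
    rcases c with _ | _ | _ <;> cases t <;> rcases a with _ | _ | _ <;> rcases b with _ | _ | _ <;>
      simp [readOn] at h <;>
    · obtain ⟨-, -, rfl, rfl, rfl⟩ := h
      simp [hk]
  · rcases c with _ | _ | _ <;> cases t <;> rcases a with _ | _ | _ <;> rcases b with _ | _ | _ <;>
      simp [lookupTrans, readOn] at h <;>
    · obtain ⟨-, -, rfl, rfl, rfl⟩ := h
      simp
  · simp [lookupTrans] at h

theorem mk₂_move_right_of_head {α : Type} [Inhabited α] {L R : List α}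
    (h : (Turing.Tape.mk₂ L R).head ≠ default) :
    ∃ L' R', (Turing.Tape.mk₂ L R).move Dir.right = Turing.Tape.mk₂ L' R' ∧
      R'.length + 1 = R.length := by
  cases R with
  | nil => exact absurd (mk₂_head_nil L) h
  | cons a R => exact ⟨a :: L, R, mk₂_move_right _ _ _, rfl⟩

/-- On any inputs the lookup phase ends after linearly many steps. -/
theorem exists_halt_lookup (k : ℕ) : ∀ {q : LookupState}, q ≠ .rewind →
    ∀ (o : Turing.Tape (Option Bool)) (Lw Rw Lv Rv : List (Option Bool)) (z : Turing.Tape Γ),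
    Rw.length + Rv.length ≤ k →
    ∃ n ≤ k, ∃ c, stepN (lookupMachine M bit bot).step n
      ⟨.inr q, o, Turing.Tape.mk₂ Lw Rw, Turing.Tape.mk₂ Lv Rv, z⟩ = some c ∧
      (lookupMachine M bit bot).step c = none := by
  induction k with
  | zero =>
    intro q hq o Lw Rw Lv Rv z h
    obtain ⟨rfl, rfl⟩ : Rw = [] ∧ Rv = [] := by
      constructor <;> apply List.eq_nil_of_length_eq_zero <;> omega
    refine ⟨0, le_rfl, _, rfl, ?_⟩
    rw [step_lookup, Option.map_eq_none_iff, Option.eq_none_iff_forall_ne_some]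
    rintro ⟨o', mo, ma, mb, q'⟩ hr
    rcases (lookupTrans_moves hq hr).2 with ⟨-, h, -⟩ | ⟨-, -, h⟩ | ⟨-, h, -⟩ <;> exact h rfl
  | succ k ih =>
    intro q hq o Lw Rw Lv Rv z h
    cases hr : lookupTrans q o.head (Turing.Tape.mk₂ Lw Rw).head (Turing.Tape.mk₂ Lv Rv).head with
    | none => exact ⟨0, Nat.zero_le _, _, rfl, by rw [step_lookup, hr, Option.map_none]⟩
    | some r =>
      obtain ⟨o', mo, ma, mb, q'⟩ := r
      obtain ⟨hq', hm⟩ := lookupTrans_moves hq hr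
      have key : ∃ Lw' Rw' Lv' Rv', moveOpt ma (Turing.Tape.mk₂ Lw Rw) = Turing.Tape.mk₂ Lw' Rw' ∧
          moveOpt mb (Turing.Tape.mk₂ Lv Rv) = Turing.Tape.mk₂ Lv' Rv' ∧
          Rw'.length + Rv'.length ≤ k := by
        rcases hm with ⟨rfl, ha, rfl⟩ | ⟨rfl, rfl, hb⟩ | ⟨rfl, ha, rfl, hb⟩
        · obtain ⟨Lw', Rw', e, hl⟩ := mk₂_move_right_of_head ha
          exact ⟨Lw', Rw', Lv, Rv, e, rfl, by omega⟩
        · obtain ⟨Lv', Rv', e, hl⟩ := mk₂_move_right_of_head hb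
          exact ⟨Lw, Rw, Lv', Rv', rfl, e, by omega⟩
        · obtain ⟨Lw', Rw', e, hl⟩ := mk₂_move_right_of_head ha
          obtain ⟨Lv', Rv', e', hl'⟩ := mk₂_move_right_of_head hb
          exact ⟨Lw', Rw', Lv', Rv', e, e', by omega⟩
      obtain ⟨Lw', Rw', Lv', Rv', e, e', hl⟩ := key
      obtain ⟨n, hn, c, hc, hc'⟩ := ih hq' (moveOpt mo (o.write o')) Lw' Rw' Lv' Rv' z hl
      refine ⟨n + 1, by omega, c, stepN_head ?_ hc, hc'⟩
      rw [step_lookup, hr, Option.map_some]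
      simp only [e, e']

/-- Rewinding the second input. -/
theorem stepN_rewind (o Tw : Turing.Tape (Option Bool)) (z : Turing.Tape Γ) (u r : Str) :
    stepN (lookupMachine M bit bot).step (u.length + 1)
      ⟨.inr .rewind, o, Tw, (Turing.Tape.mk₂ (u.map some) (r.map some)).move Dir.left, z⟩ =
      some ⟨.inr .flag₁, o, Tw, Turing.Tape.mk₂ [none] ((u.reverse ++ r).map some), z⟩ := by
  induction u generalizing r with
  | nil =>
    rw [List.length_nil, Nat.zero_add, stepN_one, step_lookup]
    simp [lookupTrans, moveOpt, Turing.Tape.write_self, Option.default_eq_none]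
  | cons a u ih =>
    have e : (a :: u).reverse ++ r = u.reverse ++ a :: r := by simp
    rw [e]
    refine stepN_head ?_ (ih (a :: r))
    rw [step_lookup]
    simp [lookupTrans, moveOpt, Turing.Tape.write_self]

/-- The configuration of the lookup phase in which the input tape `t` is `T` and the other one is
`S`. -/
def lookupCfg (Λ : Type) (t : Bool) (q : LookupState) (o T S : Turing.Tape (Option Bool))
    (z : Turing.Tape Γ) : ACfg (CheckState Λ ⊕ LookupState) Γ :=
  ⟨.inr q, o, cond t S T, cond t T S, z⟩

/-- The code of a field with contents `s`: each bit `b` becomes the pair `1b`, the order of the bits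
is reversed, and the pair `01` marks the end. -/
def fieldCode (s : Str) : Str := (s.reverse.flatMap fun b => [true, b]) ++ [false, true]

/-- The code of a table: each block consists of a flag, which tells whether it is the last one, and
of two fields. -/
def tableCode : List (Str × Str) → Str
  | [] => []
  | x :: l => true :: l.isEmpty :: (fieldCode x.1 ++ (fieldCode x.2 ++ tableCode l))

theorem tableCode_nil : tableCode [] = [] := rfl

/-- The value found in two tables: the first component of a block of the second table, if the first
table is not longer, and the second component of a block of the first table, otherwise; the number
of the block is that of the last block in the shorter table. -/
def lookupValue : List (Str × Str) → List (Str × Str) → Str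
  | [_], y :: _ => y.1
  | x :: _ :: _, [_] => x.2
  | _ :: x :: l, _ :: y :: l' => lookupValue (x :: l) (y :: l')
  | _, _ => []

open StateTransition (Reaches)

theorem reaches_skip (k : Fin 5) (o S : Turing.Tape (Option Bool)) (z : Turing.Tape Γ) (s R : Str)
    (L : List (Option Bool)) :
    ∃ L', Reaches (lookupMachine M bit bot).step
      (lookupCfg Λ (decide (3 ≤ k)) (.skip k none) o
        (Turing.Tape.mk₂ L ((fieldCode s ++ R).map some)) S z)
      (lookupCfg Λ (decide (3 ≤ k)) (skipNext k) o (Turing.Tape.mk₂ L' (R.map some)) S z) := by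
  rw [fieldCode]
  generalize s.reverse = u
  induction u generalizing L with
  | nil =>
    refine ⟨some true :: some false :: L, ?_⟩
    refine .head (b := lookupCfg Λ (decide (3 ≤ k)) (.skip k (some false)) o
      (Turing.Tape.mk₂ (some false :: L) (some true :: R.map some)) S z) ?_ (.single ?_)
    all_goals
      rw [lookupCfg, Option.mem_def, step_lookup]
      simp only [lookupTrans, lookupCfg]
      generalize decide (3 ≤ k) = t
      cases t <;> simp [readOn, moveOpt, Turing.Tape.write_self]
  | cons b u ih =>
    obtain ⟨L', hL'⟩ := ih (some b :: some true :: L)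
    refine ⟨L', ?_⟩
    refine .head (b := lookupCfg Λ (decide (3 ≤ k)) (.skip k (some true)) o
      (Turing.Tape.mk₂ (some true :: L)
        (some b :: ((u.flatMap fun b => [true, b]) ++ [false, true] ++ R).map some)) S z) ?_
      (.head ?_ hL')
    all_goals
      rw [lookupCfg, Option.mem_def, step_lookup]
      simp only [lookupTrans, lookupCfg]
      generalize decide (3 ≤ k) = t
      cases t <;> simp [readOn, moveOpt, Turing.Tape.write_self]

theorem mk₁_nil_move_left {α : Type} [Inhabited α] :
    (Turing.Tape.mk₁ ([] : List α)).move Dir.left = Turing.Tape.mk₁ [] := by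
  simp [Turing.Tape.mk₁, mk₂_singleton_default]

theorem reaches_copy (t : Bool) (S : Turing.Tape (Option Bool)) (z : Turing.Tape Γ) (s R : Str)
    (L : List (Option Bool)) :
    ∃ T, Reaches (lookupMachine M bit bot).step
      (lookupCfg Λ t (.copy t none) (Turing.Tape.mk₁ [])
        (Turing.Tape.mk₂ L ((fieldCode s ++ R).map some)) S z)
      (lookupCfg Λ t .done (Turing.Tape.mk₁ (s.map some)) T S z) := by
  have key : ∀ (u x : Str) (L : List (Option Bool)), ∃ T, Reaches (lookupMachine M bit bot).step
      (lookupCfg Λ t (.copy t none) ((Turing.Tape.mk₁ (x.map some)).move Dir.left)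
        (Turing.Tape.mk₂ L (((u.flatMap fun b => [true, b]) ++ [false, true] ++ R).map some)) S z)
      (lookupCfg Λ t .done (Turing.Tape.mk₁ ((u.reverse ++ x).map some)) T S z) := by
    intro u
    induction u with
    | nil =>
      intro x L
      refine ⟨Turing.Tape.mk₂ (some true :: some false :: L) (R.map some), ?_⟩
      refine .head (b := lookupCfg Λ t (.copy t (some false))
        ((Turing.Tape.mk₁ (x.map some)).move Dir.left)
        (Turing.Tape.mk₂ (some false :: L) (some true :: R.map some)) S z) ?_ (.single ?_)
      all_goals
        rw [lookupCfg, Option.mem_def, step_lookup]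
        simp only [lookupTrans, lookupCfg]
        cases t <;> simp [readOn, moveOpt, Turing.Tape.write_self, Turing.Tape.move_left_right]
    | cons b u ih =>
      intro x L
      obtain ⟨T, hT⟩ := ih (b :: x) (some b :: some true :: L)
      refine ⟨T, ?_⟩
      have e : (b :: u).reverse ++ x = u.reverse ++ b :: x := by simp
      rw [e]
      refine .head (b := lookupCfg Λ t (.copy t (some true))
        ((Turing.Tape.mk₁ (x.map some)).move Dir.left)
        (Turing.Tape.mk₂ (some true :: L)
        (some b :: ((u.flatMap fun b => [true, b]) ++ [false, true] ++ R).map some)) S z) ?_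
        (.head ?_ hT)
      · rw [lookupCfg, Option.mem_def, step_lookup]
        simp only [lookupTrans, lookupCfg]
        cases t <;> simp [readOn, moveOpt, Turing.Tape.write_self]
      · rw [lookupCfg, Option.mem_def, step_lookup]
        simp only [lookupTrans, lookupCfg]
        cases t <;> simp [readOn, moveOpt, mk₁_move_left_write]
  obtain ⟨T, hT⟩ := key s.reverse [] L
  refine ⟨T, ?_⟩
  simpa [mk₁_nil_move_left, fieldCode] using hT

/-- Reading the flags of the current blocks. -/
theorem reaches_flags (o : Turing.Tape (Option Bool)) (z : Turing.Tape Γ)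
    (Lw Lv : List (Option Bool)) (Rw Rv : Str) :
    Reaches (lookupMachine M bit bot).step
      ⟨.inr .flag₁, o, Turing.Tape.mk₂ Lw ((true :: Rw).map some),
        Turing.Tape.mk₂ Lv ((true :: Rv).map some), z⟩
      ⟨.inr .flag₂, o, Turing.Tape.mk₂ (some true :: Lw) (Rw.map some),
        Turing.Tape.mk₂ (some true :: Lv) (Rv.map some), z⟩ := by
  refine .single ?_
  rw [Option.mem_def, step_lookup]
  simp [lookupTrans, moveOpt, Turing.Tape.write_self]

/-- The machine looks up the right value in two tables. -/
theorem reaches_lookupValue {bw bv : List (Str × Str)} (hw : bw ≠ []) (hv : bv ≠ [])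
    (Lw Lv : List (Option Bool)) (Rw Rv : Str) (z : Turing.Tape Γ) :
    ∃ Tw Tv, Reaches (lookupMachine M bit bot).step
      ⟨.inr .flag₁, Turing.Tape.mk₁ [], Turing.Tape.mk₂ Lw ((tableCode bw ++ Rw).map some),
        Turing.Tape.mk₂ Lv ((tableCode bv ++ Rv).map some), z⟩
      ⟨.inr .done, Turing.Tape.mk₁ ((lookupValue bw bv).map some), Tw, Tv, z⟩ := by
  fun_induction lookupValue bw bv generalizing Lw Lv with
  | case1 x y l =>
    obtain ⟨T, hT⟩ := reaches_copy (M := M) (bit := bit) (bot := bot) true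
      (Turing.Tape.mk₂ (some true :: Lw)
        ((true :: (fieldCode x.1 ++ (fieldCode x.2 ++ []) ++ Rw)).map some)) z y.1
      (fieldCode y.2 ++ tableCode l ++ Rv) (some l.isEmpty :: some true :: Lv)
    refine ⟨_, T, (reaches_flags _ z Lw Lv _ _).trans (.head ?_ hT)⟩
    rw [Option.mem_def, step_lookup]
    simp [lookupTrans, readOn, lookupCfg, moveOpt, Turing.Tape.write_self, tableCode_nil]
  | case2 x x' l y =>
    obtain ⟨L', hL'⟩ := reaches_skip (M := M) (bit := bit) (bot := bot) 0 (Turing.Tape.mk₁ [])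
      (Turing.Tape.mk₂ (some true :: Lv)
        ((true :: (fieldCode y.1 ++ (fieldCode y.2 ++ []) ++ Rv)).map some)) z x.1
      (fieldCode x.2 ++ tableCode (x' :: l) ++ Rw) (some false :: some true :: Lw)
    obtain ⟨T, hT⟩ := reaches_copy (M := M) (bit := bit) (bot := bot) false
      (Turing.Tape.mk₂ (some true :: Lv)
        ((true :: (fieldCode y.1 ++ (fieldCode y.2 ++ []) ++ Rv)).map some)) z x.2
      (tableCode (x' :: l) ++ Rw) L'
    rw [← List.append_assoc] at hT
    refine ⟨T, _, (reaches_flags _ z Lw Lv _ _).trans (.head ?_ (hL'.trans hT))⟩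
    rw [Option.mem_def, step_lookup]
    simp [lookupTrans, readOn, lookupCfg, moveOpt, Turing.Tape.write_self, tableCode_nil]
  | case3 x x' l y y' l' ih =>
    obtain ⟨L₁, h₁⟩ := reaches_skip (M := M) (bit := bit) (bot := bot) 4 (Turing.Tape.mk₁ [])
      (Turing.Tape.mk₂ (some false :: some true :: Lw)
        ((fieldCode x.1 ++ (fieldCode x.2 ++ (tableCode (x' :: l) ++ Rw))).map some)) z y.1
      (fieldCode y.2 ++ (tableCode (y' :: l') ++ Rv)) (some false :: some true :: Lv)
    obtain ⟨L₂, h₂⟩ := reaches_skip (M := M) (bit := bit) (bot := bot) 3 (Turing.Tape.mk₁ [])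
      (Turing.Tape.mk₂ (some false :: some true :: Lw)
        ((fieldCode x.1 ++ (fieldCode x.2 ++ (tableCode (x' :: l) ++ Rw))).map some)) z y.2
      (tableCode (y' :: l') ++ Rv) L₁
    obtain ⟨L₃, h₃⟩ := reaches_skip (M := M) (bit := bit) (bot := bot) 2 (Turing.Tape.mk₁ [])
      (Turing.Tape.mk₂ L₂ ((tableCode (y' :: l') ++ Rv).map some)) z x.1
      (fieldCode x.2 ++ (tableCode (x' :: l) ++ Rw)) (some false :: some true :: Lw)
    obtain ⟨L₄, h₄⟩ := reaches_skip (M := M) (bit := bit) (bot := bot) 1 (Turing.Tape.mk₁ [])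
      (Turing.Tape.mk₂ L₂ ((tableCode (y' :: l') ++ Rv).map some)) z x.2
      (tableCode (x' :: l) ++ Rw) L₃
    obtain ⟨Tw, Tv, h⟩ := ih (by simp) (by simp) L₄ L₂
    refine ⟨Tw, Tv, (reaches_flags _ z Lw Lv _ _).trans
      (.head ?_ (h₁.trans (h₂.trans (h₃.trans (h₄.trans h)))))⟩
    rw [Option.mem_def, step_lookup]
    simp [lookupTrans, lookupCfg, moveOpt, Turing.Tape.write_self]
  | case4 bw bv h1 h2 h3 =>
    exfalso
    rcases bw with _ | ⟨x, _ | ⟨x', l⟩⟩ <;> rcases bv with _ | ⟨y, _ | ⟨y', l'⟩⟩ <;> grind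

end lookup

/-! ### Computability of runs -/

section primrec

open Primrec

theorem primrec_bitSym : Primrec bitSym := Primrec.dom_finite _

theorem Tape.primrec_head : Primrec Tape.head :=
  (option_getD.comp (list_head?.comp snd) (const 0)).of_eq fun T => by
    simp [Tape.head, List.head?_eq_getElem?, List.headD_eq_head?_getD]

theorem Tape.primrec_write : Primrec₂ Tape.write :=
  (pair (fst.comp fst) (list_cons.comp snd (list_tail.comp (snd.comp fst)))).to₂

theorem Tape.primrec_move : Primrec₂ Tape.move := by
  have h : Primrec fun l : List Sym => l.headD 0 :=
    (option_getD.comp list_head? (const 0)).of_eq fun T => by simp [List.headD_eq_head?_getD]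
  refine Primrec.of_eq (f := fun x : Tape × Option Bool => Option.casesOn x.2 x.1 fun b =>
    cond b (x.1.2.headD 0 :: x.1.1, x.1.2.tail) (x.1.1.tail, x.1.1.headD 0 :: x.1.2))
    (option_casesOn snd fst (g := fun (x : Tape × Option Bool) b =>
      cond b (x.1.2.headD 0 :: x.1.1, x.1.2.tail) (x.1.1.tail, x.1.1.headD 0 :: x.1.2))
      (Primrec.cond snd ?_ ?_)) ?_
  · exact pair (list_cons.comp (h.comp (snd.comp (fst.comp fst))) (fst.comp (fst.comp fst)))
      (list_tail.comp (snd.comp (fst.comp fst)))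
  · exact pair (list_tail.comp (fst.comp (fst.comp fst)))
      (list_cons.comp (h.comp (fst.comp (fst.comp fst))) (snd.comp (fst.comp fst)))
  · rintro ⟨T, _ | _ | _⟩ <;> rfl

theorem zipWith_eq_filterMap {α β γ : Type*} (f : α → β → γ) (l : List α) (l' : List β) :
    List.zipWith f l l' = (List.range l.length).filterMap fun i =>
      l[i]?.bind fun a => l'[i]?.map (f a) := by
  induction l generalizing l' with
  | nil => rfl
  | cons a l ih =>
    rw [List.length_cons, List.range_succ_eq_map, List.filterMap_cons, List.filterMap_map]
    cases l' with
    | nil => simp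
    | cons b l' => simp [ih l']

theorem primrec_zipWith {α β γ δ : Type*} [Primcodable α] [Primcodable β] [Primcodable γ]
    [Primcodable δ] {f : α → β → γ} (hf : Primrec₂ f) {l : δ → List α} {l' : δ → List β}
    (hl : Primrec l) (hl' : Primrec l') : Primrec fun x => List.zipWith f (l x) (l' x) := by
  refine Primrec.of_eq (listFilterMap (list_range.comp (list_length.comp hl))
    (g := fun x i => (l x)[i]?.bind fun a => (l' x)[i]?.map (f a)) ?_) fun x =>
      (zipWith_eq_filterMap f _ _).symm
  refine option_bind (list_getElem?.comp (hl.comp fst) snd)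
    (g := fun (x : δ × ℕ) a => (l' x.1)[x.2]?.map (f a)) ?_
  exact option_map (list_getElem?.comp (hl'.comp (fst.comp fst)) (snd.comp fst))
    (g := fun (x : (δ × ℕ) × α) b => f x.2 b) (hf.comp (snd.comp fst) snd)

theorem primrec_find? {α β : Type*} [Primcodable α] [Primcodable β] {l : α → List β}
    {p : α → β → Bool} (hl : Primrec l) (hp : Primrec₂ p) :
    Primrec fun x => (l x).find? (p x) :=
  (list_getElem?.comp hl (list_findIdx hl hp)).of_eq fun _ =>
    List.find?_eq_getElem?_findIdx.symm

theorem Machine.primrec_instr? : Primrec₂ Machine.instr? := by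
  refine primrec_find? (l := fun x : Machine × Config => x.1.2) (p := fun x I =>
    decide (I.1 = x.2.1 ∧ I.2.1.map (fun a => a.1) = x.2.2.map Tape.head)) (snd.comp fst) ?_
  refine PrimrecPred.decide (PrimrecPred.and ?_ ?_)
  · exact Primrec.eq.comp (fst.comp snd) (fst.comp (snd.comp fst))
  · exact Primrec.eq.comp (list_map (fst.comp (snd.comp snd)) (fst.comp snd).to₂)
      (list_map (snd.comp (snd.comp fst)) (Tape.primrec_head.comp snd).to₂)

theorem Instr.primrec_exec : Primrec₂ Instr.exec :=
  (pair (snd.comp (snd.comp fst)) (primrec_zipWith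
    (f := fun (a : Action) (T : Tape) => (T.write a.2.1).move a.2.2)
    (Tape.primrec_move.comp (Tape.primrec_write.comp snd (fst.comp (snd.comp fst)))
      (snd.comp (snd.comp fst))).to₂
    (fst.comp (snd.comp fst)) (snd.comp snd))).to₂

theorem Machine.primrec_step : Primrec₂ Machine.step := by
  refine Primrec.of_eq (f := fun x : Machine × Config =>
    Option.casesOn (x.1.instr? x.2) x.2 fun I => I.exec x.2) (option_casesOn
    Machine.primrec_instr? snd (Instr.primrec_exec.comp snd (snd.comp fst)).to₂) fun x => ?_
  rw [Machine.step]
  cases x.1.instr? x.2 <;> rfl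

theorem primrec_replicate {α : Type*} [Primcodable α] (a : α) :
    Primrec fun n => List.replicate n a :=
  (list_map list_range (const a).to₂).of_eq fun n => by
    simp

theorem Machine.primrec_init : Primrec₂ Machine.init := by
  refine pair (const 0) (list_cons.comp (const Tape.blank) (list_append.comp
    (list_map snd ?_) ((primrec_replicate Tape.blank).comp (fst.comp fst))))
  exact (pair (const []) (list_map snd (primrec_bitSym.comp snd).to₂)).to₂

theorem Machine.primrec_run :
    Primrec fun x : (Machine × List Str) × ℕ => x.1.1.run x.1.2 x.2 :=
  nat_iterate snd (Machine.primrec_init.comp (fst.comp fst) (snd.comp fst))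
    (Machine.primrec_step.comp (fst.comp (fst.comp fst)) snd).to₂

theorem primrec_readBits : Primrec readBits := by
  refine Primrec.of_eq (f := fun l : List Sym => l.foldr (fun a s => if a = 1 then false :: s
    else if a = 2 then true :: s else []) []) (list_foldr .id (const [])
      (h := fun _ x => if x.1 = 1 then false :: x.2 else if x.1 = 2 then true :: x.2 else []) ?_)
      fun l => ?_
  · exact Primrec.ite (Primrec.eq.comp (fst.comp snd) (const 1))
      (list_cons.comp (const false) (snd.comp snd))
      (Primrec.ite (Primrec.eq.comp (fst.comp snd) (const 2))
        (list_cons.comp (const true) (snd.comp snd)) (const []))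
  · fun_induction readBits l with
    | case1 l ih => simpa using ih
    | case2 l ih => simpa using ih
    | case3 l h₁ h₂ =>
      rcases l with _ | ⟨a, l⟩
      · rfl
      · have h₁' : a ≠ 1 := fun h => h₁ l (by rw [h])
        have h₂' : a ≠ 2 := fun h => h₂ l (by rw [h])
        simp [h₁', h₂']

theorem Config.primrec_output : Primrec Config.output := by
  refine primrec_readBits.comp (snd.comp ?_)
  exact (option_getD.comp (list_head?.comp snd) (const Tape.blank)).of_eq fun T => by
    simp [List.headD_eq_head?_getD]

theorem primrec_sq : Primrec fun n : ℕ => n ^ 2 :=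
  (nat_mul.comp .id .id).of_eq fun n => (sq n).symm

theorem ClockedIndex.primrec_eval : Primrec₂ ClockedIndex.eval :=
  (Config.primrec_output.comp (Machine.primrec_run.comp (pair (pair (fst.comp fst)
    (list_cons.comp snd (const []))) (nat_mul.comp (snd.comp fst) (nat_add.comp
      (primrec_sq.comp (list_length.comp snd)) (const 1)))))).to₂

theorem IsQuadTime₂.computable {G : Str → Str → Str} (hG : IsQuadTime₂ G) : Computable₂ G := by
  obtain ⟨M, c, h⟩ := hG
  refine Primrec.to_comp (Primrec.of_eq (Config.primrec_output.comp (Machine.primrec_run.comp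
    (pair (pair (const M) (list_cons.comp fst (list_cons.comp snd (const []))))
    (nat_mul.comp (const c) (nat_add.comp (primrec_sq.comp (nat_add.comp (list_length.comp fst)
      (list_length.comp snd))) (const 1)))))) fun x => ?_)
  obtain ⟨t, ht, hhalt, hout⟩ := h x.1 x.2
  rw [← hout]
  exact congrArg _ (Machine.run_eq_of_halted hhalt ht)

/-! ### Computability of codes -/

theorem primrec_strNum : Primrec strNum := by
  refine Primrec.of_eq (list_foldr .id (const 1) (h := fun _ x => 2 * x.2 + x.1.toNat) ?_)
    fun s => (strNum_eq_foldr s).symm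
  exact nat_add.comp (nat_double.comp (snd.comp snd))
    ((Primrec.dom_finite Bool.toNat).comp (fst.comp snd))

theorem primrec_bits : Primrec Nat.bits := by
  have h : Primrec fun n : ℕ => ((fun x : ℕ × Str => if x.1 = 0 then x else
      (x.1 / 2, x.2 ++ [x.1.bodd]))^[n] (n, [])).2 := by
    refine snd.comp (nat_iterate .id (pair .id (const [])) (Primrec.ite ?_ snd (pair ?_ ?_)))
    · exact Primrec.eq.comp (fst.comp snd) (const 0)
    · exact nat_div.comp (fst.comp snd) (const 2)
    · exact list_append.comp (snd.comp snd) (list_cons.comp (nat_bodd.comp (fst.comp snd))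
        (const []))
  refine h.of_eq fun n => ?_
  have key : ∀ k m : ℕ, m ≤ k → ∀ s : Str, ((fun x : ℕ × Str => if x.1 = 0 then x else
      (x.1 / 2, x.2 ++ [x.1.bodd]))^[k] (m, s)).2 = s ++ m.bits := by
    intro k
    induction k with
    | zero => intro m hm s; simp [Nat.le_zero.1 hm]
    | succ k ih =>
      intro m hm s
      rw [Function.iterate_succ_apply]
      by_cases h0 : m = 0
      · subst h0
        simpa using ih 0 (Nat.zero_le _) s
      · simp only [h0, if_false]
        rw [ih (m / 2) (by omega), List.append_assoc]
        congr 1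
        conv_rhs => rw [← Nat.bit_bodd_div2 m]
        rw [Nat.bits_append_bit _ _ (fun h => ?_), Nat.div2_val]
        · rfl
        · rw [Nat.div2_val] at h
          have : m = 1 := by omega
          subst this
          rfl
  exact key n n le_rfl []

theorem primrec_fieldCode : Primrec fieldCode := by
  refine list_append.comp (list_flatMap list_reverse ?_) (const _)
  exact (list_cons.comp (const true) (list_cons.comp snd (const []))).to₂

theorem primrec_tableCode : Primrec tableCode := by
  refine Primrec.of_eq (f := fun l : List (Str × Str) => List.recOn l [] fun x l s =>
    true :: decide (l = []) :: (fieldCode x.1 ++ (fieldCode x.2 ++ s)))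
    (list_rec .id (const []) (h := fun _ (y : (Str × Str) × List (Str × Str) × Str) =>
      true :: decide (y.2.1 = []) :: (fieldCode y.1.1 ++ (fieldCode y.1.2 ++ y.2.2))) ?_)
    fun l => ?_
  · have hx : Primrec fun z : List (Str × Str) × (Str × Str) × List (Str × Str) × Str => z.2.1 :=
      fst.comp snd
    refine list_cons.comp (const true) (list_cons.comp (PrimrecPred.decide
      (Primrec.eq.comp (fst.comp (snd.comp snd)) (const []))) (list_append.comp
        (primrec_fieldCode.comp (fst.comp hx)) (list_append.comp
          (primrec_fieldCode.comp (snd.comp hx)) (snd.comp (snd.comp snd)))))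
  · induction l with
    | nil => rfl
    | cons x l ih =>
      rw [tableCode, ← ih]
      cases l <;> rfl

end primrec

/-! ### Recursively enumerable and `Π⁰₁` relations -/

theorem rePred_exists {α β : Type*} [Primcodable α] [Primcodable β] {p : α → β → Prop}
    [DecidableRel p] (hp : ComputablePred fun x : α × β => p x.1 x.2) :
    REPred fun a => ∃ b, p a b := by
  have h : Computable₂ fun (a : α) (n : ℕ) =>
      ((Encodable.decode n : Option β).map fun b => decide (p a b)).getD false := by
    refine Computable.option_getD (Computable.option_map (Computable.decode.comp Computable.snd) ?_)
      (Computable.const false)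
    exact (hp.decide.comp (Computable.pair (Computable.fst.comp Computable.fst) Computable.snd)).to₂
  refine (Partrec.dom_re (Partrec.rfind h.partrec₂)).of_eq fun a => ?_
  rw [Nat.rfind_dom']
  constructor
  · rintro ⟨n, hn, -⟩
    cases hd : (Encodable.decode n : Option β) with
    | none => simp [hd] at hn
    | some b => exact ⟨b, by simpa [hd] using hn⟩
  · rintro ⟨b, hb⟩
    exact ⟨Encodable.encode b, by simp [hb], fun _ => trivial⟩

theorem isPi01_sectionEq {α β γ : Type*} [Primcodable α] [Primcodable β] [Primcodable γ]
    [DecidableEq γ] {G : α → β → γ} (hG : Computable₂ G) : IsPi01 (sectionEq G) := by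
  have h : ComputablePred fun x : (α × α) × β => G x.1.1 x.2 ≠ G x.1.2 x.2 := by
    refine ComputablePred.not (Computable.computablePred ?_)
    have e : Computable fun x : γ × γ => decide (x.1 = x.2) :=
      (PrimrecPred.decide Primrec.eq).to_comp
    exact e.comp (Computable.pair
      (hG.comp (Computable.fst.comp Computable.fst) Computable.snd)
      (hG.comp (Computable.snd.comp Computable.fst) Computable.snd))
  exact (rePred_exists (p := fun (x : α × α) b => G x.1 b ≠ G x.2 b) h).of_eq fun x => by
    rw [sectionEq, ← ne_eq, Function.ne_iff]

theorem equivalence_sectionEq {α β γ : Type*} (G : α → β → γ) : Equivalence (sectionEq G) :=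
  ⟨fun _ => rfl, fun h => h.symm, fun h h' => h.trans h'⟩

/-- A recursively enumerable predicate is enumerated in increasing primitive recursive stages. -/
theorem REPred.exists_stages {α : Type*} [Primcodable α] {p : α → Prop} (hp : REPred p) :
    ∃ b : α → ℕ → Bool, Primrec₂ b ∧ (∀ a m n, m ≤ n → b a m = true → b a n = true) ∧
      ∀ a, p a ↔ ∃ n, b a n = true := by
  obtain ⟨c, hc⟩ := Nat.Partrec.Code.exists_code.1 hp
  refine ⟨fun a n => (Nat.Partrec.Code.evaln n c (Encodable.encode a)).isSome, ?_,
    fun a m n hmn h => ?_, fun a => ?_⟩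
  · exact Primrec.option_isSome.comp (Nat.Partrec.Code.primrec_evaln.comp (Primrec.pair
      (Primrec.pair Primrec.snd (Primrec.const c)) (Primrec.encode.comp Primrec.fst)))
  · obtain ⟨x, hx⟩ := Option.isSome_iff_exists.1 h
    exact Option.isSome_iff_exists.2 ⟨x, Nat.Partrec.Code.evaln_mono hmn hx⟩
  · have h1 : p a ↔ (c.eval (Encodable.encode a)).Dom := by
      rw [hc]
      simp [Part.assert]
    rw [h1, Part.dom_iff_mem]
    constructor
    · rintro ⟨x, hx⟩
      obtain ⟨k, hk⟩ := Nat.Partrec.Code.evaln_complete.1 hx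
      exact ⟨k, Option.isSome_iff_exists.2 ⟨x, hk⟩⟩
    · rintro ⟨k, hk⟩
      obtain ⟨x, hx⟩ := Option.isSome_iff_exists.1 hk
      exact ⟨x, Nat.Partrec.Code.evaln_sound hx⟩

/-! ### Every `Π⁰₁` equivalence relation is equality of computable functions -/

section separation

variable {S : ℕ → ℕ → Prop} {b : ℕ × ℕ → ℕ → Bool}

/-- At stage `n`, the number `x` is known to be inequivalent to all numbers to which the list `D`
assigns a value other than `v`. -/
def safe (b : ℕ × ℕ → ℕ → Bool) (D : List (ℕ × Bool)) (x n : ℕ) (v : Bool) : Bool :=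
  D.foldr (fun y r => (y.2 == v || b (x, y.1) n) && r) true

theorem safe_iff {D : List (ℕ × Bool)} {x n : ℕ} {v : Bool} :
    safe b D x n v = true ↔ ∀ y ∈ D, y.2 ≠ v → b (x, y.1) n = true := by
  induction D with
  | nil => simp [safe]
  | cons y D ih =>
    rw [List.forall_mem_cons, ← ih]
    simp only [safe, List.foldr_cons, Bool.and_eq_true, Bool.or_eq_true, beq_iff_eq]
    tauto

/-- Equivalent numbers have the same value in the list `D`. -/
def Invariant (S : ℕ → ℕ → Prop) (D : List (ℕ × Bool)) : Prop :=
  ∀ y ∈ D, ∀ y' ∈ D, S y.1 y'.1 → y.2 = y'.2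

theorem Invariant.exists_safe (hS : Equivalence S)
    (hmono : ∀ a m n, m ≤ n → b a m = true → b a n = true)
    (hb : ∀ x y, ¬ S x y ↔ ∃ n, b (x, y) n = true) {D : List (ℕ × Bool)} (hD : Invariant S D)
    (x : ℕ) : ∃ n, (safe b D x n false || safe b D x n true) = true := by
  -- The value of a number in the list that is equivalent to `x`, if there is one, will turn out to
  -- be safe.
  have h1 : ∃ v, ∀ y ∈ D, y.2 ≠ v → ¬ S x y.1 := by
    by_cases h : ∃ y ∈ D, S x y.1
    · obtain ⟨y, hy, hxy⟩ := h
      exact ⟨y.2, fun y' hy' hne h' => hne (hD y' hy' y hy (hS.trans (hS.symm h') hxy))⟩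
    · exact ⟨false, fun y hy _ hxy => h ⟨y, hy, hxy⟩⟩
  obtain ⟨v, hv⟩ := h1
  have h2 : ∃ n, ∀ y ∈ D, y.2 ≠ v → b (x, y.1) n = true := by
    clear hD
    induction D with
    | nil => exact ⟨0, by simp⟩
    | cons y D ih =>
      rw [List.forall_mem_cons] at hv
      obtain ⟨n, hn⟩ := ih hv.2
      by_cases hy : y.2 = v
      · exact ⟨n, List.forall_mem_cons.2 ⟨fun h => absurd hy h, hn⟩⟩
      · obtain ⟨m, hm⟩ := (hb x y.1).1 (hv.1 hy)
        exact ⟨max m n, List.forall_mem_cons.2 ⟨fun _ => hmono _ _ _ (le_max_left _ _) hm,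
          fun y' hy' hne => hmono _ _ _ (le_max_right _ _) (hn y' hy' hne)⟩⟩
  obtain ⟨n, hn⟩ := h2
  refine ⟨n, ?_⟩
  rw [Bool.or_eq_true, safe_iff, safe_iff]
  cases v
  · exact Or.inl hn
  · exact Or.inr hn

theorem Invariant.cons (hS : Equivalence S) (hb : ∀ x y, ¬ S x y ↔ ∃ n, b (x, y) n = true)
    {D : List (ℕ × Bool)} (hD : Invariant S D) {x n : ℕ} {v : Bool} (h : safe b D x n v = true) :
    Invariant S ((x, v) :: D) := by
  have key : ∀ y ∈ D, S x y.1 → v = y.2 := fun y hy hxy => by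
    by_contra hne
    exact (hb x y.1).2 ⟨n, safe_iff.1 h y hy (Ne.symm hne)⟩ hxy
  intro y hy y' hy' hyy
  rcases List.mem_cons.1 hy with rfl | hy <;> rcases List.mem_cons.1 hy' with rfl | hy'
  · rfl
  · exact key y' hy' hyy
  · exact (key y hy (hS.symm hyy)).symm
  · exact hD y hy y' hy' hyy

/-- The values at the start: `0` and `1` for two numbers that are inequivalent at the given stage.
-/
def startList (b : ℕ × ℕ → ℕ → Bool) (c : (ℕ × ℕ) × ℕ) : List (ℕ × Bool) :=
  cond (b c.1 c.2) [(c.1.1, false), (c.1.2, true)] []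

/-- The list `D` with a value for `x` added: it is found by waiting for a stage at which one of the
two values is safe. -/
def addValue (b : ℕ × ℕ → ℕ → Bool) (D : List (ℕ × Bool)) (x : ℕ) : Part (List (ℕ × Bool)) :=
  (Nat.rfind fun n => Part.some (safe b D x n false || safe b D x n true)).map fun n =>
    (x, !safe b D x n false) :: D

/-- The values of the numbers below `x`, after the values at the start. -/
def valueList (b : ℕ × ℕ → ℕ → Bool) (c : (ℕ × ℕ) × ℕ) (x : ℕ) : Part (List (ℕ × Bool)) :=
  Nat.rec (Part.some (startList b c)) (fun x r => r.bind fun D => addValue b D x) x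

theorem primrec_safe (hb : Primrec₂ b) : Primrec fun x : (List (ℕ × Bool) × ℕ × ℕ) × Bool =>
    safe b x.1.1 x.1.2.1 x.1.2.2 x.2 := by
  refine Primrec.list_foldr (Primrec.fst.comp Primrec.fst) (Primrec.const true)
    (h := fun (x : (List (ℕ × Bool) × ℕ × ℕ) × Bool) (y : (ℕ × Bool) × Bool) =>
      (y.1.2 == x.2 || b (x.1.2.1, y.1.1) x.1.2.2) && y.2) ?_
  refine Primrec.and.comp (Primrec.or.comp (Primrec.beq.comp (Primrec.snd.comp
    (Primrec.fst.comp Primrec.snd)) (Primrec.snd.comp Primrec.fst)) (hb.comp (Primrec.pair ?_ ?_)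
      ?_)) (Primrec.snd.comp Primrec.snd)
  · exact Primrec.fst.comp (Primrec.snd.comp (Primrec.fst.comp Primrec.fst))
  · exact Primrec.fst.comp (Primrec.fst.comp Primrec.snd)
  · exact Primrec.snd.comp (Primrec.snd.comp (Primrec.fst.comp Primrec.fst))

theorem partrec_addValue (hb : Primrec₂ b) :
    Partrec fun y : List (ℕ × Bool) × ℕ => addValue b y.1 y.2 := by
  have hsafe : ∀ v, Computable fun y : (List (ℕ × Bool) × ℕ) × ℕ => safe b y.1.1 y.1.2 y.2 v := by
    intro v
    have ha : Primrec fun y : (List (ℕ × Bool) × ℕ) × ℕ => ((y.1.1, y.1.2, y.2), v) :=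
      Primrec.pair (Primrec.pair (Primrec.fst.comp Primrec.fst) (Primrec.pair
        (Primrec.snd.comp Primrec.fst) Primrec.snd)) (Primrec.const v)
    exact ((primrec_safe hb).comp ha).to_comp
  have hor : Computable fun y : (List (ℕ × Bool) × ℕ) × ℕ =>
      (safe b y.1.1 y.1.2 y.2 false || safe b y.1.1 y.1.2 y.2 true) :=
    Primrec.or.to_comp.comp (hsafe false) (hsafe true)
  have hfind : Partrec fun y : List (ℕ × Bool) × ℕ => Nat.rfind fun n =>
      Part.some (safe b y.1 y.2 n false || safe b y.1 y.2 n true) :=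
    Partrec.rfind hor.partrec
  have hcons : Computable₂ fun (y : List (ℕ × Bool) × ℕ) (n : ℕ) =>
      (y.2, !safe b y.1 y.2 n false) :: y.1 := by
    have hpair := (Computable.pair (Computable.snd.comp Computable.fst)
      (Primrec.not.to_comp.comp (hsafe false)))
    exact Computable.list_cons.comp hpair (Computable.fst.comp Computable.fst)
  exact Partrec.map hfind hcons

theorem partrec_valueList (hb : Primrec₂ b) :
    Partrec fun y : ((ℕ × ℕ) × ℕ) × ℕ => valueList b y.1 y.2 := by
  have hstart : Computable fun y : ((ℕ × ℕ) × ℕ) × ℕ => startList b y.1 := by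
    have h1 : Primrec fun y : ((ℕ × ℕ) × ℕ) × ℕ => (y.1.1.1, false) :=
      Primrec.pair (Primrec.fst.comp (Primrec.fst.comp Primrec.fst)) (Primrec.const false)
    have h2 : Primrec fun y : ((ℕ × ℕ) × ℕ) × ℕ => (y.1.1.2, true) :=
      Primrec.pair (Primrec.snd.comp (Primrec.fst.comp Primrec.fst)) (Primrec.const true)
    have h3 := Primrec.list_cons.comp h1 (Primrec.list_cons.comp h2 (Primrec.const []))
    have h4 : Primrec fun y : ((ℕ × ℕ) × ℕ) × ℕ => b y.1.1 y.1.2 :=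
      hb.comp (Primrec.fst.comp Primrec.fst) (Primrec.snd.comp Primrec.fst)
    have h5 : Primrec fun _ : ((ℕ × ℕ) × ℕ) × ℕ => ([] : List (ℕ × Bool)) := Primrec.const []
    have h6 : Primrec fun y : ((ℕ × ℕ) × ℕ) × ℕ => startList b y.1 := Primrec.cond h4 h3 h5
    exact h6.to_comp
  have hswap : Computable fun z : (((ℕ × ℕ) × ℕ) × ℕ) × (ℕ × List (ℕ × Bool)) =>
      (z.2.2, z.2.1) :=
    Computable.pair (Computable.snd.comp Computable.snd) (Computable.fst.comp Computable.snd)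
  have hstep : Partrec₂ fun (_ : ((ℕ × ℕ) × ℕ) × ℕ) (z : ℕ × List (ℕ × Bool)) =>
      addValue b z.2 z.1 := by
    have := (partrec_addValue hb).comp hswap
    exact this
  have hrec := Partrec.nat_rec Computable.snd hstart.partrec hstep
  exact hrec

/-- A `Π⁰₁` equivalence relation on the natural numbers is the relation `E_g` for a computable
function `g`. The sections of `g` are the columns of all functions `h` with values `0` and `1` that
separate two inequivalent numbers and are computed by the recursion of `valueList`, which assigns
the same value to equivalent numbers. -/
theorem exists_computable_sectionEq (hS : Equivalence S) (hpi : IsPi01 S) :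
    ∃ g : ℕ → ℕ → ℕ, Computable₂ g ∧ ∀ x y, S x y ↔ g x = g y := by
  obtain ⟨b, hbp, hmono, hb⟩ := REPred.exists_stages hpi
  replace hb : ∀ x y, ¬ S x y ↔ ∃ n, b (x, y) n = true := fun x y => hb (x, y)
  have hinv : ∀ c x, ∃ D ∈ valueList b c x, Invariant S D := by
    intro c x
    induction x with
    | zero =>
      refine ⟨startList b c, Part.mem_some _, ?_⟩
      rw [startList]
      cases hc : b c.1 c.2 with
      | false => simp [Invariant]
      | true =>
        have hne : ¬ S c.1.1 c.1.2 := (hb _ _).2 ⟨c.2, hc⟩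
        have hne' : ¬ S c.1.2 c.1.1 := fun h => hne (hS.symm h)
        simp [Invariant, hne, hne']
    | succ x ih =>
      obtain ⟨D, hDmem, hD⟩ := ih
      obtain ⟨m, hm⟩ := hD.exists_safe hS hmono hb x
      obtain ⟨n, hn, -⟩ := Nat.rfind_min' (p := fun n => safe b D x n false || safe b D x n true) hm
      refine ⟨(x, !safe b D x n false) :: D, Part.mem_bind_iff.2 ⟨D, hDmem,
        Part.mem_map _ hn⟩, hD.cons hS hb (n := n) ?_⟩
      have := Part.mem_some_iff.1 (Nat.rfind_spec hn)
      cases h : safe b D x n false with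
      | true => simpa using h
      | false => simpa [h] using this
  choose F hF hFinv using hinv
  have hFc : Computable fun y : ((ℕ × ℕ) × ℕ) × ℕ => F y.1 y.2 :=
    (partrec_valueList hbp).of_eq_tot fun y => hF y.1 y.2
  have hsucc : ∀ c x, ∃ v, F c (x + 1) = (x, v) :: F c x := by
    intro c x
    have h := hF c (x + 1)
    rw [valueList, Part.mem_bind_iff] at h
    obtain ⟨D, hD, h⟩ := h
    rw [Part.mem_unique hD (hF c x), addValue, Part.mem_map_iff] at h
    obtain ⟨n, -, h⟩ := h
    exact ⟨_, h.symm⟩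
  choose h hh using hsucc
  have hsub : ∀ c x k, F c x ⊆ F c (x + k) := by
    intro c x k
    induction k with
    | zero => exact fun _ h => h
    | succ k ih =>
      rw [← Nat.add_assoc, hh]
      exact fun y hy => List.mem_cons_of_mem _ (ih hy)
  have hmem : ∀ c x y, x < y → (x, h c x) ∈ F c y := by
    intro c x y hxy
    obtain ⟨k, rfl⟩ := Nat.exists_eq_add_of_lt hxy
    have := hsub c (x + 1) k
    rw [show x + k + 1 = x + 1 + k by omega]
    exact this (by rw [hh]; exact List.mem_cons_self)
  have hinvar : ∀ c x y, S x y → h c x = h c y := fun c x y hxy =>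
    hFinv c (max x y + 1) _ (hmem c x _ (by omega)) _ (hmem c y _ (by omega)) hxy
  -- The values at the start are never lost, so they are the values of the two numbers for ever.
  have hsep : ∀ x y, ¬ S x y → ∃ c, h c x ≠ h c y := by
    intro x y hxy
    obtain ⟨n, hn⟩ := (hb x y).1 hxy
    refine ⟨((x, y), n), ?_⟩
    have h0 : F ((x, y), n) 0 = [(x, false), (y, true)] := by
      have : startList b ((x, y), n) = [(x, false), (y, true)] := by simp [startList, hn]
      rw [← this]
      exact Part.mem_some_iff.1 (hF ((x, y), n) 0)
    have hx : (x, false) ∈ F ((x, y), n) (0 + (max x y + 1)) := hsub _ 0 _ (by simp [h0])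
    have hy : (y, true) ∈ F ((x, y), n) (0 + (max x y + 1)) := hsub _ 0 _ (by simp [h0])
    have ex : false = h ((x, y), n) x := hFinv _ _ _ hx _ (hmem _ x _ (by omega)) (hS.refl x)
    have ey : true = h ((x, y), n) y := hFinv _ _ _ hy _ (hmem _ y _ (by omega)) (hS.refl y)
    rw [← ex, ← ey]
    simp
  have hhc : Computable fun y : ((ℕ × ℕ) × ℕ) × ℕ => h y.1 y.2 := by
    have h1 : Computable fun y : ((ℕ × ℕ) × ℕ) × ℕ =>
        ((F y.1 (y.2 + 1)).head?.map Prod.snd).getD false := by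
      have h2 : Computable fun y : ((ℕ × ℕ) × ℕ) × ℕ => (y.1, y.2 + 1) :=
        Computable.pair Computable.fst (Computable.succ.comp Computable.snd)
      have h3 : Computable fun y : ((ℕ × ℕ) × ℕ) × ℕ => (F y.1 (y.2 + 1)).head? :=
        have := Primrec.list_head?.to_comp.comp (hFc.comp h2)
        this
      have h4 : Computable₂ fun (_ : ((ℕ × ℕ) × ℕ) × ℕ) (z : ℕ × Bool) => z.2 :=
        Computable.snd.comp Computable.snd
      have h5 : Computable fun _ : ((ℕ × ℕ) × ℕ) × ℕ => false := Computable.const false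
      exact Computable.option_getD (Computable.option_map h3 h4) h5
    exact h1.of_eq fun y => by rw [hh]; rfl
  refine ⟨fun x n =>
    ((Encodable.decode n : Option ((ℕ × ℕ) × ℕ)).map fun c => (h c x).toNat).getD 0,
    ?_, fun x y => ⟨fun hxy => ?_, fun hxy => ?_⟩⟩
  · have hp : Computable fun y : (ℕ × ℕ) × ((ℕ × ℕ) × ℕ) => (y.2, y.1.1) :=
      Computable.pair Computable.snd (Computable.fst.comp Computable.fst)
    have hm : Computable₂ fun (y : ℕ × ℕ) (c : (ℕ × ℕ) × ℕ) => (h c y.1).toNat := by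
      have := (Primrec.dom_bool Bool.toNat).to_comp.comp (hhc.comp hp)
      exact this
    have hd : Computable fun y : ℕ × ℕ => (Encodable.decode y.2 : Option ((ℕ × ℕ) × ℕ)) :=
      Computable.decode.comp Computable.snd
    have h0 : Computable fun _ : ℕ × ℕ => 0 := Computable.const 0
    have hg := Computable.option_getD (Computable.option_map hd hm) h0
    exact hg
  · funext n
    simp only [hinvar _ x y hxy]
  · by_contra hne
    obtain ⟨c, hc⟩ := hsep x y hne
    have := congrFun hxy (Encodable.encode c)
    simp only [Encodable.encodek, Option.map_some, Option.getD_some] at this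
    revert hc this
    cases h c x <;> cases h c y <;> simp

end separation

/-! ### Fixing the first input of a machine -/

section hardwire

/-- The tape as an element of Mathlib's type of tapes, where trailing blanks do not matter. -/
def Tape.toTuring (T : Tape) : Turing.Tape Sym := Turing.Tape.mk₂ T.1 T.2

theorem Tape.toTuring_head (T : Tape) : T.toTuring.head = T.head := by
  obtain ⟨L, _ | ⟨a, R⟩⟩ := T <;> rfl

theorem Tape.toTuring_write_move_congr {T T' : Tape} (h : T.toTuring = T'.toTuring) (a : Sym)
    (m : Option Bool) : ((T.write a).move m).toTuring = ((T'.write a).move m).toTuring := by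
  have key : ∀ T : Tape, ∀ d, ((T.write a).move (dirCode d)).toTuring =
      moveOpt d (T.toTuring.write a) := by
    intro T d
    have h : Represents id T.toTuring T := ⟨T.1, T.2, rfl, by simp⟩
    obtain ⟨L, R, hT, hC⟩ := h.write_move rfl a d
    rw [id, List.map_id, List.map_id] at hC
    rw [hC, hT]
    rfl
  have hd : ∃ d, dirCode d = m := by
    rcases m with _ | _ | _
    exacts [⟨none, rfl⟩, ⟨some Dir.left, rfl⟩, ⟨some Dir.right, rfl⟩]
  obtain ⟨d, rfl⟩ := hd
  rw [key, key, h]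

theorem Tape.toTuring_write_head (T : Tape) : (T.write T.head).toTuring = T.toTuring := by
  obtain ⟨L, _ | ⟨a, R⟩⟩ := T
  · exact mk₂_singleton_default L
  · rfl

theorem Tape.readBits_congr {T T' : Tape} (h : T.toTuring = T'.toTuring) :
    readBits T.2 = readBits T'.2 := by
  have := congrArg Turing.Tape.right₀ h
  exact QuadTime.readBits_congr (by simpa [Turing.Tape.mk₂, Tape.toTuring] using this)

theorem map_head_congr {l l' : List Tape} (h : l.map Tape.toTuring = l'.map Tape.toTuring) :
    l.map Tape.head = l'.map Tape.head := by
  have := congrArg (List.map Turing.Tape.head) h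
  simpa [Function.comp_def, Tape.toTuring_head] using this

theorem zipWith_exec_congr (A : List Action) {l l' : List Tape}
    (h : l.map Tape.toTuring = l'.map Tape.toTuring) :
    (List.zipWith (fun (a : Action) (T : Tape) => (T.write a.2.1).move a.2.2) A l).map
        Tape.toTuring =
      (List.zipWith (fun (a : Action) (T : Tape) => (T.write a.2.1).move a.2.2) A l').map
        Tape.toTuring := by
  induction A generalizing l l' with
  | nil => rfl
  | cons a A ih =>
    rcases l with _ | ⟨T, l⟩ <;> rcases l' with _ | ⟨T', l'⟩ <;>
      simp only [List.map_nil, List.map_cons, List.cons.injEq, reduceCtorEq] at h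
    · rfl
    · simp only [List.zipWith_cons_cons, List.map_cons]
      rw [Tape.toTuring_write_move_congr h.1, ih h.2]

/-- Interchange the second and the third entry of a list: the two input tapes of a machine. -/
def swapInputs {α : Type*} : List α → List α
  | o :: a :: b :: l => o :: b :: a :: l
  | l => l

theorem swapInputs_swapInputs {α : Type*} (l : List α) : swapInputs (swapInputs l) = l := by
  rcases l with _ | ⟨o, _ | ⟨a, _ | ⟨b, l⟩⟩⟩ <;> rfl

theorem map_swapInputs {α β : Type*} (f : α → β) (l : List α) :
    (swapInputs l).map f = swapInputs (l.map f) := by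
  rcases l with _ | ⟨o, _ | ⟨a, _ | ⟨b, l⟩⟩⟩ <;> rfl

theorem zipWith_swapInputs {α β γ : Type*} (f : α → β → γ) {l : List α} {l' : List β}
    (h : l.length = l'.length) :
    List.zipWith f (swapInputs l) (swapInputs l') = swapInputs (List.zipWith f l l') := by
  rcases l with _ | ⟨o, _ | ⟨a, _ | ⟨b, l⟩⟩⟩ <;> rcases l' with _ | ⟨o', _ | ⟨a', _ | ⟨b', l'⟩⟩⟩ <;>
    simp_all [swapInputs]

/-- An instruction of a machine with two inputs, for a machine that has the first input on its first
work tape. Its states have odd numbers. -/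
def simInstr (I : Instr) : Instr := (2 * I.1 + 1, swapInputs I.2.1, 2 * I.2.2 + 1)

/-- The instruction that writes the bit `u[i]?` on the first work tape and goes left, or goes back
to the right and starts the simulation if there is no such bit; `c` is the symbol under the head of
the input tape. -/
def setupInstr (k : ℕ) (u : Str) (i : ℕ) (c : Sym) : Instr :=
  (2 * i, (0, 0, none) :: (c, c, none) ::
    (0, (u[i]?).elim (0, some true) fun b => (bitSym b, some false)) ::
      List.replicate k (0, 0, none), (u[i]?).elim 1 fun _ => 2 * (i + 1))

/-- The machine that writes `w` on its first work tape, from right to left, and then simulates `M`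
with `w` as the first input. -/
def hardwireMachine (M : Machine) (w : Str) : Machine :=
  (M.1 + 1, ((List.range (w.length + 1)).flatMap fun i =>
    [0, 1, 2].map (setupInstr M.1 w.reverse i)) ++ M.2.map simInstr)

theorem hardwireMachine_instr?_sim (M : Machine) (w : Str) {C D : Config} (hq : C.1 = 2 * D.1 + 1)
    (hT : C.2.map Tape.toTuring = (swapInputs D.2).map Tape.toTuring) :
    (hardwireMachine M w).instr? C = (M.instr? D).map simInstr := by
  rw [Machine.instr?, hardwireMachine, List.find?_append, List.find?_eq_none.2, Option.none_or,
    List.find?_map]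
  · rw [Machine.instr?]
    congr 2
    funext I
    have hh : C.2.map Tape.head = swapInputs (D.2.map Tape.head) := by
      rw [map_head_congr hT, map_swapInputs]
    simp only [Function.comp, simInstr, map_swapInputs, hh, hq, decide_eq_decide]
    refine and_congr (by omega) ⟨fun h => ?_, fun h => by rw [h]⟩
    rw [← swapInputs_swapInputs (I.2.1.map _), h, swapInputs_swapInputs]
  · intro I hI
    rw [List.mem_flatMap] at hI
    obtain ⟨i, -, hI⟩ := hI
    obtain ⟨c, -, rfl⟩ := List.mem_map.1 hI
    rw [decide_eq_true_iff, hq]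
    rintro ⟨h, -⟩
    simp only [setupInstr] at h
    omega

theorem hardwireMachine_step_sim (M : Machine) (w : Str) {C D : Config} (hq : C.1 = 2 * D.1 + 1)
    (hT : C.2.map Tape.toTuring = (swapInputs D.2).map Tape.toTuring) :
    ((hardwireMachine M w).step C).1 = 2 * (M.step D).1 + 1 ∧
      ((hardwireMachine M w).step C).2.map Tape.toTuring =
        (swapInputs (M.step D).2).map Tape.toTuring := by
  have hi := hardwireMachine_instr?_sim M w hq hT
  rw [Machine.step, Machine.step, hi]
  cases hD : M.instr? D with
  | none => exact ⟨hq, hT⟩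
  | some I =>
    have hlen : I.2.1.length = D.2.length := by
      have := List.find?_some hD
      rw [decide_eq_true_iff] at this
      simpa using congrArg List.length this.2
    refine ⟨rfl, ?_⟩
    change (List.zipWith _ (swapInputs I.2.1) C.2).map Tape.toTuring = _
    rw [zipWith_exec_congr _ hT, zipWith_swapInputs _ hlen]
    rfl

theorem hardwireMachine_step_setup (M : Machine) (w v : Str) {i : ℕ} (hi : i ≤ w.length)
    {C : Config} (hq : C.1 = 2 * i) (hT : C.2.map Tape.toTuring =
      (Tape.blank :: Tape.ofStr v :: ([], 0 :: (w.reverse.take i).reverse.map bitSym) ::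
        List.replicate M.1 Tape.blank).map Tape.toTuring) :
    (hardwireMachine M w).step C = (setupInstr M.1 w.reverse i (Tape.ofStr v).head).exec C := by
  have hh : C.2.map Tape.head = 0 :: (Tape.ofStr v).head :: 0 :: List.replicate M.1 0 := by
    rw [map_head_congr hT]
    simp [Tape.blank, Tape.head]
  have hc : (Tape.ofStr v).head ∈ [0, 1, 2] := by
    rcases v with _ | ⟨_ | _, v⟩ <;> simp [Tape.ofStr, Tape.head, bitSym]
  have hmem : setupInstr M.1 w.reverse i (Tape.ofStr v).head ∈ (hardwireMachine M w).2 :=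
    List.mem_append_left _ (List.mem_flatMap.2 ⟨i, List.mem_range.2 (by omega),
      List.mem_map.2 ⟨_, hc, rfl⟩⟩)
  have hinstr : (hardwireMachine M w).instr? C =
      some (setupInstr M.1 w.reverse i (Tape.ofStr v).head) := by
    cases hf : (hardwireMachine M w).instr? C with
    | none =>
      rw [Machine.instr?, List.find?_eq_none] at hf
      refine absurd (decide_eq_true ⟨hq.symm, ?_⟩) (hf _ hmem)
      rw [hh]
      simp [setupInstr]
    | some I =>
      have hI := List.find?_some hf
      rw [decide_eq_true_iff, hh, hq] at hI
      rcases List.mem_append.1 (List.mem_of_find?_eq_some hf) with h | h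
      · rw [List.mem_flatMap] at h
        obtain ⟨j, -, h⟩ := h
        obtain ⟨c, -, rfl⟩ := List.mem_map.1 h
        obtain ⟨h1, h2⟩ := hI
        have hj : j = i := by simp only [setupInstr] at h1; omega
        have hcc : c = (Tape.ofStr v).head := by
          simp only [setupInstr, List.map_cons, List.cons.injEq] at h2
          exact h2.2.1
        rw [hj, hcc]
      · obtain ⟨J, -, rfl⟩ := List.mem_map.1 h
        have := hI.1
        simp only [simInstr] at this
        omega
  rw [Machine.step, hinstr]

theorem zipWith_replicate_blank (k : ℕ) :
    (List.zipWith (fun (a : Action) (T : Tape) => (T.write a.2.1).move a.2.2)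
      (List.replicate k (0, 0, none)) (List.replicate k Tape.blank)).map Tape.toTuring =
      (List.replicate k Tape.blank).map Tape.toTuring := by
  rw [List.zipWith_replicate, min_self, List.map_replicate, List.map_replicate]
  exact congrArg _ (Tape.toTuring_write_head Tape.blank)

theorem hardwireMachine_run_setup (M : Machine) (w v : Str) {i : ℕ} (hi : i ≤ w.length) :
    ((hardwireMachine M w).run [v] i).1 = 2 * i ∧
      ((hardwireMachine M w).run [v] i).2.map Tape.toTuring =
        (Tape.blank :: Tape.ofStr v :: ([], 0 :: (w.reverse.take i).reverse.map bitSym) ::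
          List.replicate M.1 Tape.blank).map Tape.toTuring := by
  induction i with
  | zero =>
    refine ⟨rfl, ?_⟩
    have : Tape.toTuring ([], [0]) = Tape.toTuring Tape.blank := mk₂_singleton_default []
    simp [Machine.run, Machine.init, hardwireMachine, List.replicate_succ, this]
  | succ i ih =>
    obtain ⟨hq, hT⟩ := ih (by omega)
    have hb : w.reverse[i]? = some (w.reverse[i]'(by simpa using hi)) :=
      List.getElem?_eq_getElem _
    have hs := hardwireMachine_step_setup M w v (by omega) hq hT
    rw [Machine.run, Function.iterate_succ_apply', ← Machine.run, hs]
    refine ⟨by simp [Instr.exec, setupInstr, hb], ?_⟩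
    rw [Instr.exec, zipWith_exec_congr _ hT]
    simp only [setupInstr, hb, Option.elim_some, List.zipWith_cons_cons, List.map_cons,
      zipWith_replicate_blank]
    refine congrArg₂ List.cons (Tape.toTuring_write_head Tape.blank) (congrArg₂ List.cons
      (Tape.toTuring_write_head _) ?_)
    · rw [List.take_add_one, hb]
      simp [Tape.write, Tape.move]

/-- After `w.length + 1` steps the simulation of `M` on the inputs `w` and `v` begins. -/
theorem hardwireMachine_run (M : Machine) (w v : Str) (t : ℕ) :
    ((hardwireMachine M w).run [v] (t + (w.length + 1))).1 = 2 * (M.run [w, v] t).1 + 1 ∧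
      ((hardwireMachine M w).run [v] (t + (w.length + 1))).2.map Tape.toTuring =
        (swapInputs (M.run [w, v] t).2).map Tape.toTuring := by
  induction t with
  | zero =>
    obtain ⟨hq, hT⟩ := hardwireMachine_run_setup M w v le_rfl
    have hb : w.reverse[w.length]? = none := by simp
    have hs := hardwireMachine_step_setup M w v le_rfl hq hT
    rw [Nat.zero_add, Machine.run, Function.iterate_succ_apply', ← Machine.run, hs]
    refine ⟨by simp [Instr.exec, setupInstr, Machine.run, Machine.init], ?_⟩
    rw [Instr.exec, zipWith_exec_congr _ hT]
    simp only [setupInstr, hb, Option.elim_none, List.zipWith_cons_cons, List.map_cons,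
      zipWith_replicate_blank]
    simp only [Machine.run, Machine.init, Function.iterate_zero, id, List.map_cons, List.map_nil,
      List.cons_append, List.nil_append, swapInputs]
    refine congrArg₂ List.cons (Tape.toTuring_write_head Tape.blank) (congrArg₂ List.cons
      (Tape.toTuring_write_head _) (congrArg₂ List.cons ?_ rfl))
    simp only [Tape.write, Tape.move, Tape.toTuring, Tape.ofStr, List.tail_cons, List.headD_cons]
    rw [List.take_of_length_le (by simp), List.reverse_reverse]
    have := mk₂_move_right ([] : List Sym) (w.map bitSym) default
    rw [← mk₂_nil_move_left, Turing.Tape.move_left_right] at this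
    exact this.symm
  | succ t ih =>
    rw [Nat.add_right_comm, Machine.run, Machine.run, Function.iterate_succ_apply',
      Function.iterate_succ_apply', ← Machine.run, ← Machine.run]
    exact hardwireMachine_step_sim M w ih.1 ih.2

/-- The clocked machine for the section at `w` of the function that `M` computes with at most
`c * (n ^ 2 + 1)` steps on inputs of total length `n`. -/
def hardwire (M : Machine) (c : ℕ) (w : Str) : ClockedIndex :=
  (hardwireMachine M w, w.length + 1 + 2 * c * (w.length ^ 2 + 1))

theorem eval_hardwire {M : Machine} {c : ℕ} {G : Str → Str → Str}
    (h : ∀ w v : Str, ∃ t ≤ c * ((w.length + v.length) ^ 2 + 1),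
      M.Halted (M.run [w, v] t) ∧ (M.run [w, v] t).output = G w v) (w v : Str) :
    (hardwire M c w).eval v = G w v := by
  obtain ⟨t, ht, hhalt, hout⟩ := h w v
  obtain ⟨hq, hT⟩ := hardwireMachine_run M w v t
  have hle : t + (w.length + 1) ≤
      (w.length + 1 + 2 * c * (w.length ^ 2 + 1)) * (v.length ^ 2 + 1) := by
    -- This follows from `(a + b) ^ 2 ≤ 2 * a ^ 2 + 2 * b ^ 2`.
    have h1 : (w.length + v.length) ^ 2 + 1 ≤ 2 * (w.length ^ 2 + 1) * (v.length ^ 2 + 1) := by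
      zify
      nlinarith [sq_nonneg ((w.length : ℤ) - v.length), sq_nonneg ((w.length : ℤ) * v.length)]
    have h2 := ht.trans (Nat.mul_le_mul_left c h1)
    have h3 : w.length + 1 ≤ (w.length + 1) * (v.length ^ 2 + 1) :=
      Nat.le_mul_of_pos_right _ (by omega)
    calc t + (w.length + 1) ≤ c * (2 * (w.length ^ 2 + 1) * (v.length ^ 2 + 1)) +
          (w.length + 1) * (v.length ^ 2 + 1) := Nat.add_le_add h2 h3
      _ = _ := by ring
  have hhalt' : (hardwireMachine M w).Halted
      ((hardwireMachine M w).run [v] (t + (w.length + 1))) := by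
    rw [Machine.Halted, hardwireMachine_instr?_sim M w hq hT, Option.map_eq_none_iff]
    exact hhalt
  rw [ClockedIndex.eval, hardwire, Machine.run_eq_of_halted hhalt' hle, ← hout]
  set C := (hardwireMachine M w).run [v] (t + (w.length + 1))
  set D := M.run [w, v] t
  rw [Config.output, Config.output]
  rcases hC : C.2 with _ | ⟨T, l⟩ <;> rcases hD : D.2 with _ | ⟨T', _ | ⟨a, _ | ⟨b, l'⟩⟩⟩ <;>
    simp only [hC, hD, swapInputs, List.map_nil, List.map_cons, List.cons.injEq,
      reduceCtorEq] at hT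
  · rfl
  · exact Tape.readBits_congr hT.1
  · exact Tape.readBits_congr hT.1
  · exact Tape.readBits_congr hT.1

end hardwire

open Primrec in
theorem primrec_hardwire (M : Machine) (c : ℕ) : Primrec (hardwire M c) := by
  have hbit : Primrec fun y : (Str × ℕ) × Sym => y.1.1.reverse[y.1.2]? :=
    list_getElem?.comp (list_reverse.comp (fst.comp fst)) (snd.comp fst)
  have hact : Primrec fun y : (Str × ℕ) × Sym => (y.1.1.reverse[y.1.2]?).elim
      ((0, some true) : Sym × Option Bool) fun b => (bitSym b, some false) :=
    (option_casesOn hbit (const (0, some true))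
      (Primrec.pair (primrec_bitSym.comp snd) (const (some false))).to₂).of_eq fun y => by
      cases y.1.1.reverse[y.1.2]? <;> rfl
  have hnext : Primrec fun y : (Str × ℕ) × Sym => (y.1.1.reverse[y.1.2]?).elim 1
      fun _ => 2 * (y.1.2 + 1) :=
    (option_casesOn hbit (const 1) (nat_mul.comp (const 2) (succ.comp
      (snd.comp (fst.comp fst)))).to₂).of_eq fun y => by
      cases y.1.1.reverse[y.1.2]? <;> rfl
  have hacts : Primrec fun y : (Str × ℕ) × Sym => ((0, 0, none) :: (y.2, y.2, none) ::
      (0, (y.1.1.reverse[y.1.2]?).elim (0, some true) fun b => (bitSym b, some false)) ::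
        List.replicate M.1 (0, 0, none) : List Action) := by
    have h1 : Primrec fun y : (Str × ℕ) × Sym => ((y.2, y.2, none) : Action) :=
      Primrec.pair snd (Primrec.pair snd (const none))
    have h2 := list_cons.comp (Primrec.pair (const (0 : Sym)) hact)
      (const (List.replicate M.1 ((0, 0, none) : Action)))
    exact list_cons.comp (const (0, 0, none)) (list_cons.comp h1 h2)
  have hset : Primrec fun y : (Str × ℕ) × Sym => setupInstr M.1 y.1.1.reverse y.1.2 y.2 := by
    have h1 : Primrec fun y : (Str × ℕ) × Sym => 2 * y.1.2 :=
      nat_mul.comp (const 2) (snd.comp fst)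
    exact Primrec.pair h1 (Primrec.pair hacts hnext)
  have hsetup : Primrec fun w : Str => (List.range (w.length + 1)).flatMap fun i =>
      [0, 1, 2].map (setupInstr M.1 w.reverse i) :=
    list_flatMap (list_range.comp (succ.comp list_length))
      (list_map (const [0, 1, 2]) hset.to₂).to₂
  have hmach : Primrec fun w : Str => hardwireMachine M w :=
    Primrec.pair (const (M.1 + 1)) (list_append.comp hsetup (const (M.2.map simInstr)))
  have hclock : Primrec fun w : Str => w.length + 1 + 2 * c * (w.length ^ 2 + 1) :=
    nat_add.comp (succ.comp list_length) (nat_mul.comp (const (2 * c))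
      (succ.comp (primrec_sq.comp list_length)))
  exact Primrec.pair hmach hclock

/-! ### Certificates -/

section certificates

variable {Λ Γ : Type} [Inhabited Λ] [Inhabited Γ]
variable {M : TM0.Machine Γ Λ} {bit : Bool → Γ} {bot : Γ}

theorem checkStep_eq_none_of_halt {q : Λ} {T : Turing.Tape Γ} (h : M q T.head = none) (b : Bool) :
    checkStep M bit bot (.sim q, T) b = none := by
  cases b <;> simp [checkStep, checkTrans, h]

/-- No proper prefix of an accepted string is accepted. -/
theorem Accepts.eq_nil_of_append {v u : Str} (hv : Accepts M bit bot v)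
    (hu : Accepts M bit bot (v ++ u)) : u = [] := by
  obtain ⟨q, T, h, hq⟩ := hv
  obtain ⟨q', T', h', -⟩ := hu
  rcases u with _ | ⟨b, u⟩
  · rfl
  · have hnone : scan M bit bot (v ++ [b]) = none := by
      rw [scan_concat, h, Option.bind_some, checkStep_eq_none_of_halt hq]
    have key : ∀ u, scan M bit bot (v ++ [b] ++ u) = none := by
      intro u
      induction u using List.reverseRecOn with
      | nil => rw [List.append_nil, hnone]
      | append_singleton u a ih => rw [← List.append_assoc, scan_concat, ih, Option.bind_none]
    have := key u
    rw [List.append_assoc, List.singleton_append, h'] at this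
    cases this

/-- On any inputs the machine halts after linearly many steps. -/
theorem exists_halt (w v : Str) : ∃ n ≤ w.length + 3 * v.length + 2, ∃ c,
    stepN (lookupMachine M bit bot).step n (ACfg.init Γ (.inl .pair₁) w v) = some c ∧
      (lookupMachine M bit bot).step c = none := by
  by_cases hv : Accepts M bit bot v
  · obtain ⟨T, hT⟩ := stepN_of_accepts hv w
    have h1 := stepN_trans hT (stepN_rewind (M := M) (bit := bit) (bot := bot) (Turing.Tape.mk₁ [])
      (Turing.Tape.mk₁ (w.map some)) T v.reverse [])
    obtain ⟨n, hn, c, hc, hc'⟩ := exists_halt_lookup (M := M) (bit := bit) (bot := bot)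
      (w.length + v.length) (q := .flag₁) (by simp) (Turing.Tape.mk₁ []) [] (w.map some) [none]
      ((v.reverse.reverse ++ []).map some) T (by simp)
    refine ⟨_, ?_, c, stepN_trans h1 hc, hc'⟩
    rw [List.length_reverse]
    omega
  · obtain ⟨n, hn, s, rest, x, h, h'⟩ := halt_of_not_accepts hv w
    exact ⟨n, by omega, _, h, h'⟩

/-- On a table as the first input and an accepted table as the second one, the output is the
value that is found in the tables. -/
theorem exists_stepN_lookupValue {bw bv : List (Str × Str)} (hw : bw ≠ []) (hv : bv ≠ [])
    (Rw Rv : Str) (ha : Accepts M bit bot (tableCode bv ++ Rv)) : ∃ n c,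
    stepN (lookupMachine M bit bot).step n
      (ACfg.init Γ (.inl .pair₁) (tableCode bw ++ Rw) (tableCode bv ++ Rv)) = some c ∧
      (lookupMachine M bit bot).step c = none ∧
        c.out = Turing.Tape.mk₁ ((lookupValue bw bv).map some) := by
  obtain ⟨T, hT⟩ := stepN_of_accepts ha (tableCode bw ++ Rw)
  have h1 := stepN_trans hT (stepN_rewind (M := M) (bit := bit) (bot := bot) (Turing.Tape.mk₁ [])
    (Turing.Tape.mk₁ ((tableCode bw ++ Rw).map some)) T (tableCode bv ++ Rv).reverse [])
  rw [List.reverse_reverse, List.append_nil] at h1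
  obtain ⟨Tw, Tv, h2⟩ := reaches_lookupValue (M := M) (bit := bit) (bot := bot) hw hv [] [none]
    Rw Rv T
  obtain ⟨n, hn⟩ := exists_stepN_iff_reaches.2 h2
  exact ⟨_, _, stepN_trans h1 hn, by rw [step_lookup]; rfl, rfl⟩

section concrete

variable [Fintype (CheckState Λ ⊕ LookupState)] [Fintype Γ]
variable {eQ : CheckState Λ ⊕ LookupState → ℕ} {eΓ : Γ → Sym}

theorem halted_and_output (hQ : Function.Injective eQ) (hΓ : Function.Injective eΓ)
    (h0 : eΓ default = 0) (hq : eQ (.inl .pair₁) = 0) {w v : Str} {n : ℕ}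
    {c : ACfg (CheckState Λ ⊕ LookupState) Γ}
    (h : stepN (lookupMachine M bit bot).step n (ACfg.init Γ (.inl .pair₁) w v) = some c)
    (hc : (lookupMachine M bit bot).step c = none) :
    ((lookupMachine M bit bot).machine eQ eΓ).Halted
        (((lookupMachine M bit bot).machine eQ eΓ).run [w, v] n) ∧
      (((lookupMachine M bit bot).machine eQ eΓ).run [w, v] n).1 = eQ c.state ∧
      ∀ s : Str, c.out = Turing.Tape.mk₁ (s.map some) →
        (((lookupMachine M bit bot).machine eQ eΓ).run [w, v] n).output = s := by
  have hr := Trans.representsCfg_run hQ hΓ h0 hq h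
  refine ⟨hr.halted hQ hΓ h0 hc, ?_⟩
  obtain ⟨To, Tw, Tv, Tz, e, ho, -⟩ := hr
  rw [e]
  refine ⟨rfl, fun s hs => ?_⟩
  rw [hs] at ho
  exact ho.readBits

/-- Acceptance is visible in the state of the machine after it has read the second input. -/
theorem accepts_iff_state (hQ : Function.Injective eQ) (hΓ : Function.Injective eΓ)
    (h0 : eΓ default = 0) (hq : eQ (.inl .pair₁) = 0) (v : Str) : Accepts M bit bot v ↔
      (((lookupMachine M bit bot).machine eQ eΓ).run [[], v] (v.length + 1)).1 =
        eQ (.inr .rewind) := by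
  constructor
  · intro hv
    obtain ⟨T, hT⟩ := stepN_of_accepts hv []
    obtain ⟨_, _, _, _, e, -⟩ := Trans.representsCfg_run hQ hΓ h0 hq hT
    rw [e]
  · intro h
    by_contra hv
    obtain ⟨n, hn, s, rest, x, hs, hx⟩ := halt_of_not_accepts hv []
    obtain ⟨hhalt, hstate, -⟩ := halted_and_output hQ hΓ h0 hq hs hx
    rw [Machine.run_eq_of_halted hhalt (by omega), hstate] at h
    cases hQ h

end concrete

theorem computablePred_accepts [Finite Λ] [Finite Γ] : ComputablePred (Accepts M bit bot) := by
  obtain ⟨eQ, hQ, hq⟩ := exists_code_nat (CheckState Λ ⊕ LookupState) (.inl .pair₁)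
  obtain ⟨eΓ, hΓ, h0⟩ := exists_code_nat Γ default
  have := Fintype.ofFinite (CheckState Λ ⊕ LookupState)
  have := Fintype.ofFinite Γ
  have h1 : Primrec fun v : Str => ([[], v] : List Str) :=
    Primrec.list_cons.comp (Primrec.const []) (Primrec.list_cons.comp Primrec.id (Primrec.const []))
  have h2 : Primrec fun v : Str =>
      ((lookupMachine M bit bot).machine eQ eΓ).run [[], v] (v.length + 1) :=
    Machine.primrec_run.comp (Primrec.pair (Primrec.pair (Primrec.const _) h1)
      (Primrec.succ.comp Primrec.list_length))
  have h3 : PrimrecPred fun v : Str =>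
      (((lookupMachine M bit bot).machine eQ eΓ).run [[], v] (v.length + 1)).1 =
        eQ (.inr .rewind) := Primrec.eq.comp (Primrec.fst.comp h2) (Primrec.const _)
  exact (Computable.computablePred h3.decide.to_comp).of_eq fun v =>
    (accepts_iff_state hQ hΓ h0 hq v).symm

/-- For every computable sequence of strings that are made of pairs of bits other than `00` there
is a machine that accepts exactly one extension of each of them, and nothing else. -/
theorem exists_certificates {s : ℕ → Str} (hs : Computable s) (hcode : ∀ n, PairCode (s n)) :
    ∃ (Λ Γ : Type) (_ : Inhabited Λ) (_ : Finite Λ) (_ : Inhabited Γ) (_ : Finite Γ)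
      (M : TM0.Machine Γ Λ) (bit : Bool → Γ) (bot : Γ) (p : ℕ → Str), Computable p ∧
        (∀ v, Accepts M bit bot v ↔ v ∈ Set.range p) ∧ ∀ n, ∃ r, p n = s n ++ r := by
  classical
  have hnum : Computable fun n => strNum (s n ++ [false, false]) :=
    primrec_strNum.to_comp.comp (Primrec.list_append.to_comp.comp hs (Computable.const _))
  have hP : REPred fun m => ∃ n, strNum (s n ++ [false, false]) = m := by
    refine rePred_exists (p := fun m n => strNum (s n ++ [false, false]) = m) ?_
    have e : Computable fun x : ℕ × ℕ => decide (x.1 = x.2) :=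
      (PrimrecPred.decide Primrec.eq).to_comp
    have := e.comp (Computable.pair (hnum.comp Computable.snd) Computable.fst)
    exact Computable.computablePred this
  obtain ⟨Λ, Γ, _, _, _, _, M, bit, bot, hM⟩ := exists_TM0_of_rePred _ hP
  let ext : ℕ → ℕ → Str := fun n i =>
    s n ++ [false, false] ++ [false, false] ++ List.replicate i false
  have hex : ∀ n, ∃ i, Accepts M bit bot (ext n i) := by
    intro n
    obtain ⟨i, hi⟩ := (TM0_eval_dom_iff _ _).1 ((hM (s n ++ [false, false])).2 ⟨n, rfl⟩)
    exact ⟨i, (hcode n).accepts hi⟩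
  have hext : Computable fun x : ℕ × ℕ => ext x.1 x.2 := by
    have h1 := Primrec.list_append.to_comp.comp (hs.comp (Computable.fst (α := ℕ) (β := ℕ)))
      (Computable.const [false, false])
    have h2 := Primrec.list_append.to_comp.comp h1 (Computable.const [false, false])
    exact Primrec.list_append.to_comp.comp h2
      ((primrec_replicate false).to_comp.comp Computable.snd)
  have hdec : Computable fun x : ℕ × ℕ => decide (Accepts M bit bot (ext x.1 x.2)) :=
    computablePred_accepts.decide.comp hext
  have hfind : Computable fun n => Nat.find (hex n) := by
    have h : Partrec fun n => Nat.rfind fun i => Part.some (decide (Accepts M bit bot (ext n i))) :=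
      Partrec.rfind hdec.partrec
    refine h.of_eq_tot fun n => ?_
    refine Nat.mem_rfind.2 ⟨?_, fun {m} hm => ?_⟩
    · simpa using Nat.find_spec (hex n)
    · simpa using Nat.find_min (hex n) hm
  refine ⟨Λ, Γ, ‹_›, inferInstance, ‹_›, inferInstance, M, bit, bot,
    fun n => ext n (Nat.find (hex n)), hext.comp (Computable.pair Computable.id hfind),
    fun v => ⟨fun hv => ?_, ?_⟩, fun n => ⟨[false, false] ++ [false, false] ++
      List.replicate (Nat.find (hex n)) false, by simp only [ext, List.append_assoc]⟩⟩
  · -- The simulated machine has halted, so `v` begins with some `s n`, and the number of zeros at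
    -- the end is the only one that leads to acceptance.
    obtain ⟨s', i, rfl, hi⟩ := hv.exists_haltsAt
    obtain ⟨n, hn⟩ := (hM _).1 ((TM0_eval_dom_iff _ _).2 ⟨i, hi⟩)
    have hs' : s n = s' := List.append_cancel_right (strNum_injective hn)
    subst hs'
    refine ⟨n, ?_⟩
    have hle : Nat.find (hex n) ≤ i := Nat.find_min' _ hv
    obtain ⟨j, rfl⟩ := Nat.exists_eq_add_of_le hle
    have hv' : Accepts M bit bot (ext n (Nat.find (hex n)) ++ List.replicate j false) := by
      have e : ext n (Nat.find (hex n)) ++ List.replicate j false =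
          ext n (Nat.find (hex n) + j) := by
        simp only [ext, List.replicate_add, List.append_assoc]
      rw [e]
      exact hv
    have := (Nat.find_spec (hex n)).eq_nil_of_append hv'
    rw [List.replicate_eq_nil_iff] at this
    subst this
    rfl
  · rintro ⟨n, rfl⟩
    exact Nat.find_spec (hex n)

end certificates

/-! ### Tables of the values of a computable function -/

section tables

theorem PairCode.singleton {c b : Bool} (h : (c || b) = true) : PairCode [c, b] :=
  PairCode.nil.concat c b h

theorem pairCode_fieldCode (s : Str) : PairCode (fieldCode s) := by
  rw [fieldCode]
  generalize s.reverse = u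
  induction u with
  | nil => exact .singleton rfl
  | cons b u ih => exact (PairCode.singleton (c := true) (b := b) rfl).append ih

theorem pairCode_tableCode (l : List (Str × Str)) : PairCode (tableCode l) := by
  induction l with
  | nil => exact .nil
  | cons x l ih =>
    exact (PairCode.singleton (c := true) (b := l.isEmpty) rfl).append
      ((pairCode_fieldCode _).append ((pairCode_fieldCode _).append ih))

theorem lookupValue_of_le {bw bv : List (Str × Str)} (hw : bw ≠ []) (h : bw.length ≤ bv.length) :
    lookupValue bw bv = ((bv[bw.length - 1]?).map Prod.fst).getD [] := by
  fun_induction lookupValue bw bv with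
  | case1 => simp
  | case2 => simp at h
  | case3 x x' l y y' l' ih => simpa using ih (by simp) (by simpa using h)
  | case4 bw bv h1 h2 h3 =>
    rcases bw with _ | ⟨x, _ | ⟨x', l⟩⟩ <;> rcases bv with _ | ⟨y, _ | ⟨y', l'⟩⟩ <;> grind

theorem lookupValue_of_lt {bw bv : List (Str × Str)} (hv : bv ≠ []) (h : bv.length < bw.length) :
    lookupValue bw bv = ((bw[bv.length - 1]?).map Prod.snd).getD [] := by
  fun_induction lookupValue bw bv with
  | case1 => simp at h
  | case2 => simp
  | case3 x x' l y y' l' ih => simpa using ih (by simp) (by simpa using h)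
  | case4 bw bv h1 h2 h3 =>
    rcases bw with _ | ⟨x, _ | ⟨x', l⟩⟩ <;> rcases bv with _ | ⟨y, _ | ⟨y', l'⟩⟩ <;> grind

/-- The table for `n`: the values of `g` at all pairs with both entries at most `n` and at least one
entry equal to `n`. -/
def valueTable (g : ℕ → ℕ → ℕ) (n : ℕ) : List (Str × Str) :=
  (List.range (n + 1)).map fun i => ((g i n).bits, (g n i).bits)

theorem length_valueTable (g : ℕ → ℕ → ℕ) (n : ℕ) : (valueTable g n).length = n + 1 := by
  simp [valueTable]

theorem valueTable_ne_nil (g : ℕ → ℕ → ℕ) (n : ℕ) : valueTable g n ≠ [] := by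
  simp [valueTable]

theorem lookupValue_valueTable (g : ℕ → ℕ → ℕ) (x n : ℕ) :
    lookupValue (valueTable g x) (valueTable g n) = (g x n).bits := by
  rcases le_or_gt x n with h | h
  · rw [lookupValue_of_le (valueTable_ne_nil g x) (by simpa [length_valueTable]),
      length_valueTable, valueTable]
    simp [Nat.lt_succ_of_le h]
  · rw [lookupValue_of_lt (valueTable_ne_nil g n) (by simpa [length_valueTable]),
      length_valueTable, valueTable]
    simp [Nat.lt_succ_of_lt h]

theorem computable_list_map_range {α σ : Type*} [Primcodable α] [Primcodable σ] {k : α → ℕ}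
    {f : α → ℕ → σ} (hk : Computable k) (hf : Computable₂ f) :
    Computable fun a => (List.range (k a)).map (f a) := by
  have h := Computable.nat_rec (h := fun (a : α) (y : ℕ × List σ) => y.2 ++ [f a y.1]) hk
    (Computable.const []) (by
      have h1 : Computable fun z : α × ℕ × List σ => f z.1 z.2.1 :=
        hf.comp Computable.fst (Computable.fst.comp Computable.snd)
      have h2 : Computable fun z : α × ℕ × List σ => z.2.2 := Computable.snd.comp Computable.snd
      have h3 := Primrec.list_append.to_comp.comp h2
        (Computable.list_cons.comp h1 (Computable.const []))
      exact h3)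
  refine h.of_eq fun a => ?_
  induction k a with
  | zero => rfl
  | succ m ih => rw [List.range_succ, List.map_append, ← ih]; rfl

theorem computable_tableCode_valueTable {g : ℕ → ℕ → ℕ} (hg : Computable₂ g) :
    Computable fun n => tableCode (valueTable g n) := by
  have h1 : Computable fun x : ℕ × ℕ => (g x.2 x.1).bits :=
    primrec_bits.to_comp.comp (hg.comp Computable.snd Computable.fst)
  have h2 : Computable fun x : ℕ × ℕ => (g x.1 x.2).bits :=
    primrec_bits.to_comp.comp (hg.comp Computable.fst Computable.snd)
  have h3 : Computable₂ fun n i : ℕ => ((g i n).bits, (g n i).bits) := Computable.pair h1 h2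
  have h4 : Computable fun n => valueTable g n := computable_list_map_range Computable.succ h3
  exact primrec_tableCode.to_comp.comp h4

/-- A computable function becomes quadratic time computable if its arguments are padded
appropriately. -/
theorem exists_quadTime_padding {g : ℕ → ℕ → ℕ} (hg : Computable₂ g) :
    ∃ (G : Str → Str → Str) (p : ℕ → Str), IsQuadTime₂ G ∧ Computable p ∧
      (∀ x n, G (p x) (p n) = (g x n).bits) ∧
        ∀ w v, v ∉ Set.range p → G w v = (0 : ℕ).bits := by
  obtain ⟨Λ, Γ, _, _, _, _, M, bit, bot, p, hp, haccept, hpre⟩ :=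
    exists_certificates (computable_tableCode_valueTable hg) fun n => pairCode_tableCode _
  obtain ⟨eQ, hQ, hq⟩ := exists_code_nat (CheckState Λ ⊕ LookupState) (.inl .pair₁)
  obtain ⟨eΓ, hΓ, h0⟩ := exists_code_nat Γ default
  have := Fintype.ofFinite (CheckState Λ ⊕ LookupState)
  have := Fintype.ofFinite Γ
  let N := (lookupMachine M bit bot).machine eQ eΓ
  have hhalt : ∀ w v : Str, ∃ t ≤ 6 * ((w.length + v.length) ^ 2 + 1),
      N.Halted (N.run [w, v] t) := by
    intro w v
    obtain ⟨n, hn, c, hc, hc'⟩ := exists_halt (M := M) (bit := bit) (bot := bot) w v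
    refine ⟨n, ?_, (halted_and_output hQ hΓ h0 hq hc hc').1⟩
    nlinarith [Nat.zero_le w.length, Nat.zero_le v.length]
  -- On inputs that are not of the form `p x` and `p n`, the function `G` is whatever the machine
  -- computes.
  let G : Str → Str → Str := fun w v =>
    (N.run [w, v] (6 * ((w.length + v.length) ^ 2 + 1))).output
  have hG : ∀ w v n c, stepN (lookupMachine M bit bot).step n
      (ACfg.init Γ (.inl .pair₁) w v) = some c → (lookupMachine M bit bot).step c = none →
        ∀ s : Str, c.out = Turing.Tape.mk₁ (s.map some) → G w v = s := by
    intro w v n c hc hc' s hs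
    obtain ⟨h1, -, h2⟩ := halted_and_output hQ hΓ h0 hq hc hc'
    obtain ⟨t, ht, hN⟩ := hhalt w v
    have e1 := Machine.run_eq_of_halted hN ht
    have e2 := Machine.run_eq_of_halted hN (le_max_left t n)
    have e3 := Machine.run_eq_of_halted h1 (le_max_right t n)
    rw [← h2 s hs]
    change (N.run _ _).output = (N.run _ _).output
    rw [e1, ← e2, e3]
  refine ⟨G, p, ⟨N, 6, fun w v => ?_⟩, hp, fun x n => ?_, fun w v hv => ?_⟩
  · obtain ⟨t, ht, hN⟩ := hhalt w v
    exact ⟨t, ht, hN, by rw [← Machine.run_eq_of_halted hN ht]⟩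
  · obtain ⟨r, hr⟩ := hpre x
    obtain ⟨r', hr'⟩ := hpre n
    have ha := (haccept (p n)).2 ⟨n, rfl⟩
    rw [hr'] at ha
    obtain ⟨m, c, hc, hc', hout⟩ := exists_stepN_lookupValue (valueTable_ne_nil g x)
      (valueTable_ne_nil g n) r r' ha
    rw [lookupValue_valueTable] at hout
    rw [hr, hr']
    exact hG _ _ m c hc hc' _ hout
  · obtain ⟨m, -, s, rest, x, hc, hc'⟩ := halt_of_not_accepts (mt (haccept v).1 hv) w
    exact hG w v m _ hc hc' [] rfl

end tables

/-! ### Complete equivalence relations -/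

theorem bits_injective : Function.Injective Nat.bits := fun m n h =>
  Nat.digits_inj_iff.1 (by rw [Nat.digits_two_eq_bits, Nat.digits_two_eq_bits, h])

theorem compReducible_eval {S : ℕ → ℕ → Prop} (hS : Equivalence S) (hpi : IsPi01 S) :
    CompReducible S fun e e' : ClockedIndex => e.eval = e'.eval := by
  obtain ⟨g, hg, hSg⟩ := exists_computable_sectionEq hS hpi
  obtain ⟨G, p, ⟨M, c, hM⟩, hp, hGp, hG⟩ := exists_quadTime_padding hg
  refine ⟨fun x => hardwire M c (p x), (primrec_hardwire M c).to_comp.comp hp, fun x y => ?_⟩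
  rw [hSg]
  have heval : ∀ w, (hardwire M c w).eval = G w := fun w => funext (eval_hardwire hM w)
  simp only [heval]
  constructor
  · intro h
    funext v
    by_cases hv : v ∈ Set.range p
    · obtain ⟨n, rfl⟩ := hv
      rw [hGp, hGp, h]
    · rw [hG _ _ hv, hG _ _ hv]
  · intro h
    funext n
    have := congrFun h (p n)
    rw [hGp, hGp] at this
    exact bits_injective this

theorem isPi01CompleteEquivalence_eval :
    IsPi01CompleteEquivalence fun e e' : ClockedIndex => e.eval = e'.eval :=
  ⟨equivalence_sectionEq ClockedIndex.eval,
    isPi01_sectionEq (G := ClockedIndex.eval) ClockedIndex.primrec_eval.to_comp,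
    fun _ hS hpi => compReducible_eval hS hpi⟩

/-- The values of all clocked machines on all strings, as a function of numbers. -/
def universalValue (i n : ℕ) : ℕ :=
  ((Encodable.decode (α := ClockedIndex) i).bind fun e =>
    (Encodable.decode (α := Str) n).map fun w => Encodable.encode (e.eval w)).getD 0

theorem computable_universalValue : Computable₂ universalValue := by
  have h1 : Primrec fun x : ((ℕ × ℕ) × ClockedIndex) × Str =>
      Encodable.encode (x.1.2.eval x.2) := by
    have := Primrec.encode.comp (ClockedIndex.primrec_eval.comp
      (Primrec.snd.comp (Primrec.fst (α := (ℕ × ℕ) × ClockedIndex) (β := Str))) Primrec.snd)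
    exact this
  have h2 : Primrec fun x : (ℕ × ℕ) × ClockedIndex => (Encodable.decode (α := Str) x.1.2).map
      fun w => Encodable.encode (x.2.eval w) :=
    Primrec.option_map (Primrec.decode.comp (Primrec.snd.comp Primrec.fst)) h1.to₂
  have h3 : Primrec fun x : ℕ × ℕ => (Encodable.decode (α := ClockedIndex) x.1).bind fun e =>
      (Encodable.decode (α := Str) x.2).map fun w => Encodable.encode (e.eval w) :=
    Primrec.option_bind (Primrec.decode.comp Primrec.fst) h2.to₂
  exact (Primrec.option_getD.comp h3 (Primrec.const 0)).to_comp

theorem universalValue_encode (e : ClockedIndex) (w : Str) :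
    universalValue (Encodable.encode e) (Encodable.encode w) = Encodable.encode (e.eval w) := by
  simp [universalValue]

/-- A quadratic time computable function whose sections include padded versions of all unary
quadratic time functions. -/
theorem exists_isPi01CompleteEquivalence_sectionEq :
    ∃ G : Str → Str → Str, IsQuadTime₂ G ∧ IsPi01CompleteEquivalence (sectionEq G) := by
  obtain ⟨G, p, hGq, hp, hGp, hG⟩ := exists_quadTime_padding computable_universalValue
  refine ⟨G, hGq, equivalence_sectionEq G, isPi01_sectionEq hGq.computable, fun S hS hpi => ?_⟩
  obtain ⟨f, hf, hSf⟩ := compReducible_eval hS hpi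
  refine ⟨fun x => p (Encodable.encode (f x)), hp.comp (Computable.encode.comp hf), fun x y => ?_⟩
  rw [hSf]
  constructor
  · intro h
    have hU : ∀ n, universalValue (Encodable.encode (f x)) n =
        universalValue (Encodable.encode (f y)) n := fun n => by simp [universalValue, h]
    funext v
    by_cases hv : v ∈ Set.range p
    · obtain ⟨n, rfl⟩ := hv
      rw [hGp, hGp, hU]
    · rw [hG _ _ hv, hG _ _ hv]
  · intro h
    funext w
    have := congrFun h (p (Encodable.encode w))
    rw [hGp, hGp, universalValue_encode, universalValue_encode] at this
    exact Encodable.encode_injective (bits_injective this)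

end QuadTime

theorem theorem3p3 :
    (∀ g : ℕ → ℕ → ℕ, Computable₂ g →
      ∃ (G : QuadTime.Str → QuadTime.Str → QuadTime.Str) (p : ℕ → QuadTime.Str),
        QuadTime.IsQuadTime₂ G ∧ Computable p ∧
        (∀ x n, G (p x) (p n) = (g x n).bits) ∧
        ∀ w v, v ∉ Set.range p → G w v = (0 : ℕ).bits) ∧
    (∃ G : QuadTime.Str → QuadTime.Str → QuadTime.Str,
      QuadTime.IsQuadTime₂ G ∧
      QuadTime.IsPi01CompleteEquivalence (QuadTime.sectionEq G)) ∧
    QuadTime.IsPi01CompleteEquivalence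
      (fun e e' : QuadTime.ClockedIndex => e.eval = e'.eval) := by
  exact ⟨fun _ hg => QuadTime.exists_quadTime_padding hg,
    QuadTime.exists_isPi01CompleteEquivalence_sectionEq, QuadTime.isPi01CompleteEquivalence_eval⟩
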